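/- A *vote* over a set $\mathcal C$ of $m\ge 1$ candidates is a complete strict order on $\mathcal C$. For a profile $P$ of $N$ votes and $x\neq y$ in $\mathcal C$, let $D(x,y)$ be the number of voters who prefer $x$ to $y$ minus the number of voters who prefer $y$ to $x$. Consider the following voting rules. * *Maximin*: the winners are the candidates $x$ that maximize $\min_{y\ne x}D(x,y)$. * *Copeland*: the winners are the candidates $x$ that maximize $|\{y\neq x: D(x,y)>0\}|$. * *Bucklin*: the winners are the candidates $x$ that minimize the least $\ell$ such that more than half of the voters rank $x$ in their first $\ell$ positions. * *Plurality with runoff*: two candidates with the highest plurality scores (numbers of first positions) are selected, and the winner is the one of them that is preferred to the other by a majority. Ties are broken in all possible ways: $w$ is a winner iff there is $y\ne w$ with $D(w,y)\ge 0$ such that no third candidate has a larger plurality score than $w$ or $y$. (If $m=1$, the only candidate wins.) A candidate $w$ is an *$\varepsilon$-winner* of $P$ if $w$ can be made a winner by changing at most $\varepsilon N$ of the $N$ votes. A *one-pass algorithm with $s$ bits of memory* has memory contents in $\{0,1\}^s$; depending on its current memory content it either tosses a fair coin (its only source of randomness) and updates its memory depending on the outcome, or reads the next vote of the stream and updates its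 memory depending on that vote; if it asks for a vote after the end of the stream, it stops with an output determined by its memory content. **Theorem.** Let $r$ be one of the four rules above and let $0<c_1\le c_2$. There is a constant $K$, depending only on $c_1,c_2$, such that for all integers $m,n\ge1$ and all reals $\varepsilon,\delta>0$ there is a one-pass algorithm, which may depend on $m,n,\varepsilon,\delta$ (and on $r,c_1,c_2$), with at most $$K\Big(m^2\big(\log\log m+\log\tfrac1\varepsilon+\log\log\tfrac1\delta\big)+\log\log n\Big)$$ bits of memory, such that for every integer $N\in[c_1n,c_2n]$ and every stream of $N$ votes over $m$ candidates, the algorithm stops with probability $1$ and outputs, with probability at least $1-\delta$ over its coin tosses, an $\varepsilon$-winner of the stream for the rule $r$. Here $\log x$ stands for $\max\{1,\log_2 x\}$. -/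

import Mathlib

/-- A vote over the candidates `Fin m`, i.e. a complete strict order on them, given by the position
of every candidate: `v x = 0` means that `x` is ranked first, and `x` is preferred to `y` when
`v x < v y`. -/
abbrev Vote (m : ℕ) : Type := Equiv.Perm (Fin m)

/-- A profile of `n` votes over `m` candidates, in the order in which the votes are cast. -/
abbrev Profile (m n : ℕ) : Type := Fin n → Vote m

/-- A voting rule assigns a set of winners to every profile, for all numbers of candidates and of
voters. -/
abbrev VotingRule : Type := ∀ m n : ℕ, Profile m n → Set (Fin m)

section Rules

variable {m n : ℕ}

/-- The number of voters that prefer `x` to `y`. -/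
def numPrefer (P : Profile m n) (x y : Fin m) : ℕ :=
  (Finset.univ.filter fun i => P i x < P i y).card

/-- The weight of the edge `(x, y)` of the weighted majority graph. -/
def majority (P : Profile m n) (x y : Fin m) : ℤ :=
  (numPrefer P x y : ℤ) - (numPrefer P y x : ℤ)

/-- `min_{y ≠ x} D(x, y)`; it is `⊤` if there is no other candidate. -/
def maximinScore (P : Profile m n) (x : Fin m) : WithTop ℤ :=
  (Finset.univ.erase x).inf fun y => ((majority P x y : ℤ) : WithTop ℤ)

/-- The number of candidates that `x` beats in a pairwise comparison. -/
def copelandScore (P : Profile m n) (x : Fin m) : ℕ :=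
  (Finset.univ.filter fun y => y ≠ x ∧ 0 < majority P x y).card

/-- The number of voters that rank `x` in one of their first `l` positions. -/
def numTop (P : Profile m n) (x : Fin m) (l : ℕ) : ℕ :=
  (Finset.univ.filter fun i => (P i x : ℕ) < l).card

/-- The least `l` such that more than half of the voters rank `x` in their first `l` positions. -/
noncomputable def bucklinScore (P : Profile m n) (x : Fin m) : ℕ :=
  sInf {l : ℕ | n < 2 * numTop P x l}

/-- The number of voters that rank `x` first. -/
def pluralityScore (P : Profile m n) (x : Fin m) : ℕ := numTop P x 1

/-- `x` and `y` may be selected as the top two candidates according to the plurality score, for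
some way of breaking ties between plurality scores. -/
def IsTopTwo (P : Profile m n) (x y : Fin m) : Prop :=
  x ≠ y ∧ ∀ z, z ≠ x → z ≠ y →
    pluralityScore P z ≤ pluralityScore P x ∧ pluralityScore P z ≤ pluralityScore P y

end Rules

/-- The winners are the candidates with maximum maximin score. -/
def maximinRule : VotingRule := fun _ _ P => {w | ∀ x, maximinScore P x ≤ maximinScore P w}

/-- The winners are the candidates with maximum Copeland score. -/
def copelandRule : VotingRule := fun _ _ P => {w | ∀ x, copelandScore P x ≤ copelandScore P w}

/-- The winners are the candidates with minimum Bucklin score. -/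
def bucklinRule : VotingRule := fun _ _ P => {w | ∀ x, bucklinScore P w ≤ bucklinScore P x}

/-- Plurality with runoff: `w` wins if it may be selected as one of the top two candidates
according to the plurality score and does not lose the pairwise comparison against the other one.
A candidate without opponents wins. -/
def runoffRule : VotingRule := fun _ _ P =>
  {w | (∀ x, x = w) ∨ ∃ y, IsTopTwo P w y ∧ 0 ≤ majority P w y}

/-- `w` is an `ε`-winner: it can be made a winner by changing at most `ε n` of the `n` votes. -/
def IsEpsWinner (r : VotingRule) (ε : ℝ) {m n : ℕ} (P : Profile m n) (w : Fin m) : Prop :=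
  ∃ Q : Profile m n, w ∈ r m n Q ∧ ((Finset.univ.filter fun i => P i ≠ Q i).card : ℝ) ≤ ε * n

/-- What a memory content tells a one-pass algorithm to do: toss a fair coin and pass to a new
memory content that depends on the outcome, or read the next item of the stream and pass to a new
memory content that depends on the item; if the stream has ended, stop with output `out`. -/
inductive StreamInstr (V O : Type) (s : ℕ) : Type
  | toss (next : Bool → (Fin s → Bool)) : StreamInstr V O s
  | read (next : V → (Fin s → Bool)) (out : O) : StreamInstr V O s

/-- A one-pass streaming algorithm with `s` bits of memory, items in `V` and outputs in `O`, whose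
only source of randomness is a fair coin. The `s` bits hold everything that is remembered, both
between two items of the stream and between two coin tosses. -/
structure StreamAlgorithm (V O : Type) (s : ℕ) : Type where
  start : Fin s → Bool
  instr : (Fin s → Bool) → StreamInstr V O s

namespace StreamAlgorithm

variable {V O : Type} {s : ℕ}

/-- One step from a configuration: the memory content and the unread part of the stream. -/
noncomputable def step (A : StreamAlgorithm V O s) :
    (Fin s → Bool) × List V → PMF ((Fin s → Bool) × List V)
  | (b, l) =>
    match A.instr b, l with
    | .toss next, l => (PMF.uniformOfFintype Bool).map fun c => (next c, l)
    | .read next _, v :: l => PMF.pure (next v, l)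
    | .read _ _, [] => PMF.pure (b, [])

/-- The distribution of the configuration after `t` steps on the stream `l`. -/
noncomputable def run (A : StreamAlgorithm V O s) (l : List V) :
    ℕ → PMF ((Fin s → Bool) × List V)
  | 0 => PMF.pure (A.start, l)
  | t + 1 => (A.run l t).bind A.step

/-- The output in a configuration, if the algorithm has stopped there. -/
def output (A : StreamAlgorithm V O s) : (Fin s → Bool) × List V → Option O
  | (b, l) =>
    match A.instr b, l with
    | .read _ out, [] => some out
    | _, _ => none

/-- The probability that the algorithm, run on the stream `l`, stops with an output in `G`. The
probability that it has done so within `t` steps is nondecreasing in `t`. -/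
noncomputable def outputProb (A : StreamAlgorithm V O s) (l : List V) (G : Set O) : ENNReal :=
  ⨆ t : ℕ, (A.run l t).toOuterMeasure {c | ∃ o ∈ A.output c, o ∈ G}

end StreamAlgorithm

/-- `A` solves the `(ε, δ)`-winner determination problem for the rule `r` on the profile `P`, whose
votes are streamed in order: it stops almost surely, and with probability at least `1 - δ` its
output is an `ε`-winner. -/
def SolvesWinner (r : VotingRule) (ε δ : ℝ) {m n s : ℕ}
    (A : StreamAlgorithm (Vote m) (Fin m) s) (P : Profile m n) : Prop :=
  A.outputProb (List.ofFn P) Set.univ = 1 ∧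
    ENNReal.ofReal (1 - δ) ≤ A.outputProb (List.ofFn P) {w | IsEpsWinner r ε P w}

/-- The binary logarithm as it is used in asymptotic bounds: truncated below at `1`. -/
noncomputable def lg (x : ℝ) : ℝ := max 1 (Real.logb 2 x)

/-!
The algorithm keeps a Bernoulli sample of the votes, of rate `2⁻ᵏ` and of expected size proportional
to `Λ = ε⁻² log (m / δ)`, but remembers only its counts: for every pair of candidates how many
sampled voters prefer the one to the other, and for every candidate and position how many sampled
voters rank the candidate at least that high. These are `2 m²` counters up to `O(Λ)`, hence
`O(m² (log log m + log (1 / ε) + log log (1 / δ)))` bits. Whether a vote is sampled is decided by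
tossing the coin up to `k ≤ log₂ n` times, and counting these tosses takes `O(log log n)` bits. If
`n < Λ`, all votes are counted. The distribution of the output is computed in
`StreamAlgorithm.le_outputProb_sampler`, and a Chernoff bound with a union bound over the counters
(`bernoulliSample_concentration`) shows that with probability at least `1 - δ` all scaled counts
deviate from the counts of the stream by at most `τ = O(ε N)`, where in addition `m ≤ 2 ^ τ`.

It remains to find, from counts with error `τ`, a candidate that becomes a winner by changing `O(τ)`
votes (`RobustRule`). A winner of the sample itself may not do, so the candidate is chosen with
respect to the tolerance, and the votes are changed by moving it to the top.
* Copeland: the candidate `w` with the most comparisons that are won or nearly tied according to the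
  estimates. All of these can be turned into wins, and this number bounds the true scores of all
  other candidates.
* Maximin: the candidate `w` with the maximum estimated score. Another candidate with a true score
  above `4 τ` would beat `w` clearly, contrary to the choice of `w`. So only the comparisons of `w`
  with margin at most `4 τ` have to be improved.
* Bucklin: a candidate that nearly has a majority in the first `l` positions, for the least `l` for
  which there is one.
* Runoff: the better one of two candidates with the highest estimated plurality scores, after a case
  distinction on the voters that can be used for the repair (`exists_runoff_repair`).

For Copeland and maximin, one set of `O(τ)` voters has to improve up to `m - 1` comparisons by `4 τ`
voters each. In each of them a quarter of all voters can help, so such a set exists by a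
derandomized sampling argument (`exists_hitting_set`); this is where `m ≤ 2 ^ τ` is needed.
-/

/-! ### Sampling a stream with a fair coin -/

/-- The distribution of the event that `k` tosses of a fair coin all come up heads. -/
noncomputable def allHeads : ℕ → PMF Bool
  | 0 => PMF.pure true
  | k + 1 => (PMF.uniformOfFintype Bool).bind fun b => if b then allHeads k else PMF.pure false

/-- Bernoulli sampling: every item of the list is kept independently with probability `2⁻ᵏ`. -/
noncomputable def bernoulliSample {V : Type} (k : ℕ) : List V → PMF (List V)
  | [] => PMF.pure []
  | v :: l => (allHeads k).bind fun b =>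
      (bernoulliSample k l).map fun S => if b then v :: S else S

namespace StreamAlgorithm

variable {V O : Type} {s : ℕ}

/-- The distribution of the configuration `t` steps after the configuration `c`. -/
noncomputable def runFrom (A : StreamAlgorithm V O s) :
    (Fin s → Bool) × List V → ℕ → PMF ((Fin s → Bool) × List V)
  | c, 0 => PMF.pure c
  | c, t + 1 => (A.step c).bind fun c' => A.runFrom c' t

theorem runFrom_bind_step (A : StreamAlgorithm V O s) (c : (Fin s → Bool) × List V) (t : ℕ) :
    (A.runFrom c t).bind A.step = A.runFrom c (t + 1) := by
  induction t generalizing c with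
  | zero => simp [runFrom]
  | succ t ih =>
    rw [runFrom, PMF.bind_bind, runFrom]
    simp_rw [ih]

theorem run_eq_runFrom (A : StreamAlgorithm V O s) (l : List V) (t : ℕ) :
    A.run l t = A.runFrom (A.start, l) t := by
  induction t with
  | zero => rfl
  | succ t ih => rw [run, ih, runFrom_bind_step]

section step

variable {A : StreamAlgorithm V O s} {b : Fin s → Bool}

theorem step_of_toss {next : Bool → Fin s → Bool} (h : A.instr b = .toss next) (l : List V) :
    A.step (b, l) = (PMF.uniformOfFintype Bool).map fun c => (next c, l) := by
  simp [step, h]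

theorem step_of_read_cons {next : V → Fin s → Bool} {o : O} (h : A.instr b = .read next o)
    (v : V) (l : List V) : A.step (b, v :: l) = PMF.pure (next v, l) := by
  simp [step, h]

theorem step_of_read_nil {next : V → Fin s → Bool} {o : O} (h : A.instr b = .read next o) :
    A.step (b, []) = PMF.pure (b, []) := by
  simp [step, h]

theorem output_of_read_nil {next : V → Fin s → Bool} {o : O} (h : A.instr b = .read next o) :
    A.output (b, []) = some o := by
  simp [output, h]

end step

variable {M : Type} {k : ℕ}

/-- The algorithm that keeps a memory of type `M`, which `upd` updates with every item of a
Bernoulli sample of rate `2⁻ᵏ`, and that finally outputs `out` of the memory. Besides the memory its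
state holds a number `j ≤ k + 1`: for `1 ≤ j ≤ k` there are `j` tosses left that have to come up
heads, for `j = 0` the next item is sampled and for `j = k + 1` it is skipped. -/
noncomputable def sampler (e : Fin (k + 2) × M ↪ (Fin s → Bool)) (upd : M → V → M) (init : M)
    (out : M → O) : StreamAlgorithm V O s :=
  haveI : Nonempty (Fin (k + 2) × M) := ⟨(0, init)⟩
  { start := e (Fin.ofNat (k + 2) k, init)
    instr := fun b =>
      let q := Function.invFun e b
      if (q.1 : ℕ) = 0 then .read (fun v => e (Fin.ofNat (k + 2) k, upd q.2 v)) (out q.2)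
      else if (q.1 : ℕ) = k + 1 then .read (fun _ => e (Fin.ofNat (k + 2) k, q.2)) (out q.2)
      else .toss fun c =>
        if c then e (Fin.ofNat (k + 2) (q.1 - 1), q.2) else e (Fin.ofNat (k + 2) (k + 1), q.2) }

section sampler

variable (e : Fin (k + 2) × M ↪ (Fin s → Bool)) (upd : M → V → M) (init : M) (out : M → O)

theorem sampler_instr (q : Fin (k + 2) × M) : (sampler e upd init out).instr (e q) =
    if (q.1 : ℕ) = 0 then .read (fun v => e (Fin.ofNat (k + 2) k, upd q.2 v)) (out q.2)
    else if (q.1 : ℕ) = k + 1 then .read (fun _ => e (Fin.ofNat (k + 2) k, q.2)) (out q.2)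
    else .toss fun c =>
      if c then e (Fin.ofNat (k + 2) (q.1 - 1), q.2)
      else e (Fin.ofNat (k + 2) (k + 1), q.2) := by
  have : Nonempty (Fin (k + 2) × M) := ⟨(0, init)⟩
  simp only [sampler, Function.leftInverse_invFun e.injective q]

theorem sampler_instr_zero (c : M) :
    (sampler e upd init out).instr (e (Fin.ofNat (k + 2) 0, c)) =
      .read (fun v => e (Fin.ofNat (k + 2) k, upd c v)) (out c) := by
  rw [sampler_instr, if_pos (by simp [Fin.ofNat])]

theorem sampler_instr_last (c : M) :
    (sampler e upd init out).instr (e (Fin.ofNat (k + 2) (k + 1), c)) =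
      .read (fun _ => e (Fin.ofNat (k + 2) k, c)) (out c) := by
  have hv : ((Fin.ofNat (k + 2) (k + 1) : Fin (k + 2)) : ℕ) = k + 1 := by
    simp only [Fin.ofNat]; exact Nat.mod_eq_of_lt (by omega)
  rw [sampler_instr, if_neg (by simp only [hv]; omega), if_pos hv]

theorem sampler_instr_succ (c : M) {j : ℕ} (hj : j + 1 ≤ k) :
    (sampler e upd init out).instr (e (Fin.ofNat (k + 2) (j + 1), c)) =
      .toss fun b => if b then e (Fin.ofNat (k + 2) j, c)
        else e (Fin.ofNat (k + 2) (k + 1), c) := by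
  have hv : ((Fin.ofNat (k + 2) (j + 1) : Fin (k + 2)) : ℕ) = j + 1 := by
    simp only [Fin.ofNat]; exact Nat.mod_eq_of_lt (by omega)
  rw [sampler_instr, if_neg (by simp only [hv]; omega), if_neg (by simp only [hv]; omega)]
  simp only [hv, Nat.add_sub_cancel]

theorem map_output_runFrom_sampler_toss (c : M) (l : List V) (T : ℕ) (R : Bool → PMF (Option O))
    (hR : ∀ t, T ≤ t →
      ((sampler e upd init out).runFrom (e (Fin.ofNat (k + 2) 0, c), l) t).map
        (sampler e upd init out).output = R true)
    (hR' : ∀ t, T ≤ t →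
      ((sampler e upd init out).runFrom (e (Fin.ofNat (k + 2) (k + 1), c), l) t).map
        (sampler e upd init out).output = R false)
    (j : ℕ) (hj : j ≤ k) (t : ℕ) (ht : T + j ≤ t) :
    ((sampler e upd init out).runFrom (e (Fin.ofNat (k + 2) j, c), l) t).map
        (sampler e upd init out).output = (allHeads j).bind R := by
  induction j generalizing t with
  | zero => rw [hR t (by omega), allHeads, PMF.pure_bind]
  | succ j ih =>
    obtain ⟨t, rfl⟩ : ∃ u, t = u + 1 := ⟨t - 1, by omega⟩
    rw [runFrom, step_of_toss (sampler_instr_succ e upd init out c hj), PMF.map_bind,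
      allHeads, PMF.bind_bind, PMF.bind_map]
    congr 1
    funext b
    cases b
    · simpa only [Function.comp, Bool.false_eq_true, if_false, PMF.pure_bind] using
        hR' t (by omega)
    · simpa using ih (by omega) t (by omega)

theorem map_output_runFrom_sampler (c : M) (l : List V) (t : ℕ)
    (ht : l.length * (k + 1) + k ≤ t) :
    ((sampler e upd init out).runFrom (e (Fin.ofNat (k + 2) k, c), l) t).map
        (sampler e upd init out).output =
      (bernoulliSample k l).map fun S => some (out (S.foldl upd c)) := by
  induction l generalizing c t with
  | nil =>
    -- After the end of the stream both reading states are stationary.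
    have halt : ∀ (b : Fin s → Bool) (next : V → Fin s → Bool),
        (sampler e upd init out).instr b = .read next (out c) → ∀ t,
        ((sampler e upd init out).runFrom (b, []) t).map (sampler e upd init out).output =
          PMF.pure (some (out c)) := by
      intro b next hb t
      induction t with
      | zero => rw [runFrom, PMF.pure_map, output_of_read_nil hb]
      | succ t ih => rw [runFrom, step_of_read_nil hb, PMF.pure_bind, ih]
    rw [map_output_runFrom_sampler_toss e upd init out c [] 0 (fun _ => PMF.pure (some (out c)))
      (fun t _ => halt _ _ (sampler_instr_zero e upd init out c) t)
      (fun t _ => halt _ _ (sampler_instr_last e upd init out c) t) k le_rfl t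
      (by simp at ht; omega)]
    simp [bernoulliSample, PMF.pure_map]
  | cons v l ih =>
    rw [List.length_cons] at ht
    have hT : (l.length * (k + 1) + k + 1) + k ≤ t := by linarith
    rw [map_output_runFrom_sampler_toss e upd init out c (v :: l) (l.length * (k + 1) + k + 1)
      (fun b => (bernoulliSample k l).map fun S =>
        some (out (S.foldl upd (if b then upd c v else c)))) ?_ ?_ k le_rfl t hT]
    · rw [bernoulliSample, PMF.map_bind]
      congr 1
      funext b
      rw [PMF.map_comp]
      congr 1
      funext S
      cases b <;> rfl
    · intro t ht
      obtain ⟨t, rfl⟩ : ∃ u, t = u + 1 := ⟨t - 1, by omega⟩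
      rw [runFrom, step_of_read_cons (sampler_instr_zero e upd init out c), PMF.pure_bind]
      exact ih (upd c v) t (by omega)
    · intro t ht
      obtain ⟨t, rfl⟩ : ∃ u, t = u + 1 := ⟨t - 1, by omega⟩
      rw [runFrom, step_of_read_cons (sampler_instr_last e upd init out c), PMF.pure_bind]
      exact ih c t (by omega)

/-- The sampler stops within a bounded number of steps, and its output is distributed as `out` of
the memory after a Bernoulli sample. -/
theorem le_outputProb_sampler (l : List V) (G : Set O) :
    (bernoulliSample k l).toOuterMeasure {S | out (S.foldl upd init) ∈ G} ≤
      (sampler e upd init out).outputProb l G := by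
  refine le_trans (le_of_eq ?_) (le_iSup _ (l.length * (k + 1) + k))
  have h := map_output_runFrom_sampler e upd init out init l _ le_rfl
  have h' := congrArg (fun μ : PMF (Option O) => μ.toOuterMeasure {x | ∃ o ∈ x, o ∈ G}) h
  simp only [PMF.toOuterMeasure_map_apply] at h'
  rw [run_eq_runFrom]
  refine Eq.trans ?_ h'.symm
  congr 1
  ext S
  simp

theorem outputProb_sampler_univ (l : List V) :
    (sampler e upd init out).outputProb l Set.univ = 1 := by
  refine le_antisymm (iSup_le fun t => ?_) ?_
  · rw [← (PMF.toOuterMeasure_apply_eq_one_iff (p := (sampler e upd init out).run l t)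
      Set.univ).2 (Set.subset_univ _)]
    exact MeasureTheory.measure_mono (Set.subset_univ _)
  · refine le_trans (le_of_eq ?_) (le_outputProb_sampler e upd init out l Set.univ)
    rw [eq_comm, PMF.toOuterMeasure_apply_eq_one_iff]
    intro S _
    simp

end sampler

end StreamAlgorithm

/-! ### Concentration of Bernoulli samples -/

theorem PMF.tsum_bind_mul {α β : Type} (p : PMF α) (f : α → PMF β) (h : β → ENNReal) :
    ∑' b, (p.bind f) b * h b = ∑' a, p a * ∑' b, f a b * h b := by
  simp_rw [PMF.bind_apply, ← ENNReal.tsum_mul_right, ← ENNReal.tsum_mul_left]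
  rw [ENNReal.tsum_comm]
  simp_rw [mul_assoc]

theorem PMF.tsum_map_mul {α β : Type} (p : PMF α) (f : α → β) (h : β → ENNReal) :
    ∑' b, (p.map f) b * h b = ∑' a, p a * h (f a) := by
  rw [PMF.map, PMF.tsum_bind_mul]
  congr 1
  funext a
  rw [tsum_eq_single (f a)]
  · simp
  · intro b hb
    simp [hb]

/-- Markov's inequality. -/
theorem PMF.toOuterMeasure_le_tsum_mul {α : Type} (p : PMF α) (A : Set α) (h : α → ENNReal)
    (hA : ∀ a ∈ A, 1 ≤ h a) : p.toOuterMeasure A ≤ ∑' a, p a * h a := by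
  rw [PMF.toOuterMeasure_apply]
  refine ENNReal.tsum_le_tsum fun a => ?_
  by_cases ha : a ∈ A
  · rw [Set.indicator_of_mem ha]
    exact le_mul_of_one_le_right' (hA a ha)
  · rw [Set.indicator_of_notMem ha]
    exact zero_le

theorem allHeads_apply_true (k : ℕ) : allHeads k true = ENNReal.ofReal ((1 / 2) ^ k) := by
  induction k with
  | zero => simp [allHeads]
  | succ k ih =>
    rw [allHeads, PMF.bind_apply, tsum_fintype, Fintype.sum_bool]
    simp only [PMF.uniformOfFintype_apply, Fintype.card_bool, if_true, ih, Bool.false_eq_true,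
      if_false, PMF.pure_apply]
    rw [pow_succ', ENNReal.ofReal_mul (by norm_num), one_div,
      ENNReal.ofReal_inv_of_pos (by norm_num)]
    simp

theorem allHeads_apply_false (k : ℕ) : allHeads k false = ENNReal.ofReal (1 - (1 / 2) ^ k) := by
  have h := (allHeads k).tsum_coe
  rw [tsum_fintype, Fintype.sum_bool, allHeads_apply_true] at h
  rw [ENNReal.ofReal_sub _ (by positivity), ENNReal.ofReal_one, ← h]
  exact (ENNReal.add_sub_cancel_left ENNReal.ofReal_ne_top).symm

theorem bernoulliSample_zero {V : Type} (l : List V) : bernoulliSample 0 l = PMF.pure l := by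
  induction l with
  | nil => rfl
  | cons v l ih => simp [bernoulliSample, allHeads, ih, PMF.pure_map]

/-- The moment generating function of the number of sampled items with a given property, which is
binomially distributed. -/
theorem tsum_bernoulliSample_mul_exp {V : Type} (k : ℕ) (f : V → Bool) (s : ℝ) (l : List V) :
    ∑' S, bernoulliSample k l S * ENNReal.ofReal (Real.exp (s * S.countP f)) =
      ENNReal.ofReal ((1 + (1 / 2) ^ k * (Real.exp s - 1)) ^ l.countP f) := by
  have hp : ((1 : ℝ) / 2) ^ k ≤ 1 := pow_le_one₀ (by norm_num) (by norm_num)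
  have hp0 : (0 : ℝ) < (1 / 2) ^ k := by positivity
  induction l with
  | nil =>
    rw [bernoulliSample, tsum_eq_single []]
    · simp
    · intro S hS
      simp [hS]
  | cons v l ih =>
    have hb : 0 ≤ 1 + (1 / 2) ^ k * (Real.exp s - 1) := by
      nlinarith [Real.exp_pos s]
    rw [bernoulliSample, PMF.tsum_bind_mul, tsum_fintype, Fintype.sum_bool]
    simp only [PMF.tsum_map_mul, if_true, Bool.false_eq_true, if_false, ih, allHeads_apply_true,
      allHeads_apply_false]
    by_cases hv : f v
    · simp only [List.countP_cons_of_pos hv, Nat.cast_add, Nat.cast_one, mul_add, mul_one,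
        Real.exp_add]
      simp_rw [ENNReal.ofReal_mul (Real.exp_pos _).le, ← mul_assoc]
      rw [ENNReal.tsum_mul_right, ih, ← ENNReal.ofReal_mul (pow_nonneg hb _),
        ← ENNReal.ofReal_mul hp0.le, ← ENNReal.ofReal_mul (sub_nonneg.2 hp),
        ← ENNReal.ofReal_add (by positivity) (mul_nonneg (sub_nonneg.2 hp) (pow_nonneg hb _))]
      congr 1
      ring
    · simp only [List.countP_cons_of_neg hv, ih]
      rw [← add_mul, ← ENNReal.ofReal_add hp0.le (sub_nonneg.2 hp)]
      simp

/-- Markov's inequality for the exponential moment of parameter `s`; both tails are covered, by the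
sign of `s`. -/
theorem bernoulliSample_tail {V : Type} (k : ℕ) (f : V → Bool) {s : ℝ} (hs : |s| ≤ 1) (a : ℝ)
    (l : List V) :
    (bernoulliSample k l).toOuterMeasure {S | s * a ≤ s * S.countP f} ≤
      ENNReal.ofReal (Real.exp ((1 / 2) ^ k * l.countP f * (s + s ^ 2) - s * a)) := by
  have hp : ((1 : ℝ) / 2) ^ k ≤ 1 := pow_le_one₀ (by norm_num) (by norm_num)
  have hp0 : (0 : ℝ) < (1 / 2) ^ k := by positivity
  refine (PMF.toOuterMeasure_le_tsum_mul _ _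
    (fun S => ENNReal.ofReal (Real.exp (s * S.countP f)) * ENNReal.ofReal (Real.exp (-(s * a))))
    ?_).trans ?_
  · intro S hS
    rw [← ENNReal.ofReal_mul (Real.exp_pos _).le, ← Real.exp_add, ENNReal.one_le_ofReal,
      Real.one_le_exp_iff]
    have : s * a ≤ s * S.countP f := hS
    linarith
  · simp_rw [← mul_assoc]
    rw [ENNReal.tsum_mul_right, tsum_bernoulliSample_mul_exp]
    have hb : 0 ≤ 1 + (1 / 2) ^ k * (Real.exp s - 1) := by
      nlinarith [Real.exp_pos s]
    rw [← ENNReal.ofReal_mul (pow_nonneg hb _)]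
    refine ENNReal.ofReal_le_ofReal ?_
    have h1 : 1 + (1 / 2) ^ k * (Real.exp s - 1) ≤ Real.exp ((1 / 2) ^ k * (s + s ^ 2)) := by
      have h2 := (abs_le.1 (Real.abs_exp_sub_one_sub_id_le hs)).2
      have h3 := Real.add_one_le_exp ((1 / 2) ^ k * (s + s ^ 2))
      nlinarith
    rw [sub_eq_add_neg _ (s * a), Real.exp_add]
    refine mul_le_mul_of_nonneg_right ?_ (Real.exp_pos _).le
    refine (pow_le_pow_left₀ hb h1 _).trans (le_of_eq ?_)
    rw [← Real.exp_nat_mul]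
    congr 1
    ring

/-- The Chernoff bound, with a deviation measured against the length of the whole list. -/
theorem bernoulliSample_two_sided {V : Type} (k : ℕ) (f : V → Bool) {η : ℝ} (hη : 0 < η)
    (hη2 : η ≤ 2) (l : List V) :
    (bernoulliSample k l).toOuterMeasure
        {S | η * ((1 / 2) ^ k * l.length) < |(S.countP f : ℝ) - (1 / 2) ^ k * l.countP f|} ≤
      ENNReal.ofReal (2 * Real.exp (-(η ^ 2 * ((1 / 2) ^ k * l.length) / 4))) := by
  set p : ℝ := (1 / 2) ^ k with hp
  have hp0 : 0 < p := by positivity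
  have hc : (l.countP f : ℝ) ≤ l.length := by exact_mod_cast List.countP_le_length
  have hpc : p * l.countP f * (η / 2) ^ 2 ≤ p * l.length * (η / 2) ^ 2 := by gcongr
  set c : ℝ := (l.countP f : ℝ)
  set N : ℝ := (l.length : ℝ)
  -- The parameter `± η / 2` minimizes the exponent.
  have hs : |η / 2| ≤ 1 := by rw [abs_of_pos (by positivity)]; linarith
  have hs' : |-(η / 2)| ≤ 1 := by rwa [abs_neg]
  have h1 := bernoulliSample_tail k f hs (p * c + η * (p * N)) l
  have h2 := bernoulliSample_tail k f hs' (p * c - η * (p * N)) l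
  rw [two_mul, ENNReal.ofReal_add (Real.exp_pos _).le (Real.exp_pos _).le]
  refine le_trans (MeasureTheory.measure_mono ?_) ((MeasureTheory.measure_union_le _ _).trans
    (add_le_add (h1.trans ?_) (h2.trans ?_)))
  · intro S hS
    rcases lt_abs.1 (show η * (p * N) < |(S.countP f : ℝ) - p * c| from hS) with h | h
    · left
      change η / 2 * (p * c + η * (p * N)) ≤ η / 2 * S.countP f
      exact mul_le_mul_of_nonneg_left (by linarith) (by positivity)
    · right
      change -(η / 2) * (p * c - η * (p * N)) ≤ -(η / 2) * S.countP f
      exact mul_le_mul_of_nonpos_left (by linarith) (by linarith)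
  · refine ENNReal.ofReal_le_ofReal (Real.exp_le_exp.2 ?_)
    nlinarith
  · refine ENNReal.ofReal_le_ofReal (Real.exp_le_exp.2 ?_)
    nlinarith

theorem bernoulliSample_concentration {V ι : Type} [Fintype ι] (k : ℕ) (f : ι → V → Bool) {η δ : ℝ}
    (hη : 0 < η) (hη2 : η ≤ 2) (l : List V)
    (hδ : Fintype.card ι * (2 * Real.exp (-(η ^ 2 * ((1 / 2) ^ k * l.length) / 4))) ≤ δ) :
    ENNReal.ofReal (1 - δ) ≤ (bernoulliSample k l).toOuterMeasure
      {S | ∀ i, |(S.countP (f i) : ℝ) - (1 / 2) ^ k * l.countP (f i)| ≤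
        η * ((1 / 2) ^ k * l.length)} := by
  have hδ0 : 0 ≤ δ := le_trans (by positivity) hδ
  have key := fun i => bernoulliSample_two_sided k (f i) hη hη2 l
  generalize η * ((1 / 2) ^ k * (l.length : ℝ)) = t at key ⊢
  generalize Real.exp (-(η ^ 2 * ((1 / 2) ^ k * (l.length : ℝ)) / 4)) = x at key hδ
  generalize hB : (fun i => {S : List V |
    t < |(S.countP (f i) : ℝ) - (1 / 2) ^ k * l.countP (f i)|}) = B
  have key' : ∀ i, (bernoulliSample k l).toOuterMeasure (B i) ≤ ENNReal.ofReal (2 * x) := by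
    intro i
    rw [← hB]
    exact key i
  have hG : {S : List V | ∀ i, |(S.countP (f i) : ℝ) - (1 / 2) ^ k * l.countP (f i)| ≤ t} =
      (⋃ i, B i)ᶜ := by
    ext S
    simp [← hB]
  rw [hG]
  have hbad : (bernoulliSample k l).toOuterMeasure (⋃ i, B i) ≤ ENNReal.ofReal δ := by
    refine (MeasureTheory.measure_iUnion_fintype_le _ B).trans
      ((Finset.sum_le_sum fun i _ => key' i).trans ?_)
    have hx : (0 : ℝ) ≤ Fintype.card ι := by positivity
    rw [Finset.sum_const, Finset.card_univ, nsmul_eq_mul, ← ENNReal.ofReal_natCast,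
      ← ENNReal.ofReal_mul hx]
    exact ENNReal.ofReal_le_ofReal hδ
  generalize (⋃ i, B i) = U at hbad ⊢
  have hone : 1 ≤ (bernoulliSample k l).toOuterMeasure Uᶜ +
      (bernoulliSample k l).toOuterMeasure U := by
    rw [← (PMF.toOuterMeasure_apply_eq_one_iff (p := bernoulliSample k l)
      Set.univ).2 (Set.subset_univ _), ← Set.compl_union_self U]
    exact MeasureTheory.measure_union_le _ _
  rw [ENNReal.ofReal_sub _ hδ0, ENNReal.ofReal_one, tsub_le_iff_right]
  exact hone.trans (add_le_add le_rfl hbad)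

/-! ### Saturating counters -/

/-- Counters for several properties of the items of a stream, which stop counting at `L`. -/
def countUpdate {V ι : Type} (f : ι → V → Bool) (L : ℕ) (c : ι → Fin (L + 1)) (v : V) :
    ι → Fin (L + 1) :=
  fun i => if f i v then ⟨min (c i + 1) L, by omega⟩ else c i

theorem foldl_countUpdate {V ι : Type} (f : ι → V → Bool) (L : ℕ) (c : ι → Fin (L + 1))
    (S : List V) (i : ι) :
    ((S.foldl (countUpdate f L) c i : Fin (L + 1)) : ℕ) = min (c i + S.countP (f i)) L := by
  induction S generalizing c with
  | nil => have := (c i).2; simp; omega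
  | cons v S ih =>
    rw [List.foldl_cons, ih]
    have := (c i).2
    by_cases hv : f i v
    · rw [List.countP_cons_of_pos hv]
      simp only [countUpdate, hv, if_true]
      omega
    · rw [List.countP_cons_of_neg hv]
      simp [countUpdate, hv]

/-- Counting the properties `f i` in a Bernoulli sample of rate `2⁻ᵏ`, up to `L`, takes
`log₂ ((k + 2) (L + 1) ^ |ι|)` bits. -/
theorem exists_countingAlgorithm {V O ι : Type} [Fintype ι] (f : ι → V → Bool) (k L : ℕ)
    (g : (ι → ℕ) → O) :
    ∃ A : StreamAlgorithm V O (Nat.clog 2 ((k + 2) * (L + 1) ^ Fintype.card ι)), ∀ l : List V,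
      A.outputProb l Set.univ = 1 ∧ ∀ G : Set O,
        (bernoulliSample k l).toOuterMeasure {S | g (fun i => min (S.countP (f i)) L) ∈ G} ≤
          A.outputProb l G := by
  classical
  have hcard : Fintype.card (Fin (k + 2) × (ι → Fin (L + 1))) ≤
      Fintype.card (Fin (Nat.clog 2 ((k + 2) * (L + 1) ^ Fintype.card ι)) → Bool) := by
    simpa using Nat.le_pow_clog (b := 2) (by norm_num) ((k + 2) * (L + 1) ^ Fintype.card ι)
  obtain ⟨e⟩ := Function.Embedding.nonempty_of_card_le hcard
  refine ⟨StreamAlgorithm.sampler e (countUpdate f L) 0 fun c => g fun i => c i, fun l =>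
    ⟨StreamAlgorithm.outputProb_sampler_univ _ _ _ _ l, fun G => ?_⟩⟩
  refine le_trans (le_of_eq ?_) (StreamAlgorithm.le_outputProb_sampler _ _ _ _ l G)
  simp [foldl_countUpdate]

/-! ### Moving a candidate to the top -/

section Lift

variable {m n : ℕ}

/-- The vote `v` with the candidate `w` moved to the first position. -/
def liftVote (w : Fin m) (v : Vote m) : Vote m := v.trans (Fin.cycleRange (v w))

theorem liftVote_self (w : Fin m) (v : Vote m) : (liftVote w v w : ℕ) = 0 := by
  have : NeZero m := ⟨fun h => by subst h; exact w.elim0⟩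
  simp [liftVote, Fin.cycleRange_self]

theorem liftVote_of_ne {w x : Fin m} (v : Vote m) (h : x ≠ w) :
    (liftVote w v x : ℕ) = if v x < v w then (v x : ℕ) + 1 else v x := by
  have hne : v x ≠ v w := fun h' => h (v.injective h')
  split_ifs with hlt
  · exact Fin.coe_cycleRange_of_lt hlt
  · exact congrArg Fin.val (Fin.cycleRange_of_gt (lt_of_le_of_ne (not_lt.1 hlt) hne.symm))

theorem vote_val_ne (v : Vote m) {x y : Fin m} (h : x ≠ y) : (v x : ℕ) ≠ v y :=
  fun h' => h (v.injective (Fin.ext h'))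

theorem liftVote_lt_liftVote {w x y : Fin m} (v : Vote m) (hx : x ≠ w) (hy : y ≠ w) :
    liftVote w v x < liftVote w v y ↔ v x < v y := by
  have h1 := vote_val_ne v hx
  have h2 := vote_val_ne v hy
  rw [Fin.lt_def, Fin.lt_def, liftVote_of_ne v hx, liftVote_of_ne v hy]
  simp only [Fin.lt_def]
  split_ifs <;> omega

theorem liftVote_self_lt {w y : Fin m} (v : Vote m) (hy : y ≠ w) :
    liftVote w v w < liftVote w v y := by
  have h := vote_val_ne (liftVote w v) hy
  rw [liftVote_self] at h
  rw [Fin.lt_def, liftVote_self]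
  omega

theorem le_liftVote_of_ne {w x : Fin m} (v : Vote m) (h : x ≠ w) :
    (v x : ℕ) ≤ liftVote w v x := by
  rw [liftVote_of_ne v h]
  split_ifs <;> omega

/-- The profile `P` with `w` moved to the first position by the voters in `A`. -/
def liftOn (P : Profile m n) (A : Finset (Fin n)) (w : Fin m) : Profile m n :=
  fun i => if i ∈ A then liftVote w (P i) else P i

theorem liftOn_of_mem (P : Profile m n) {A : Finset (Fin n)} (w : Fin m) {i : Fin n} (h : i ∈ A) :
    liftOn P A w i = liftVote w (P i) := if_pos h

theorem liftOn_of_notMem (P : Profile m n) {A : Finset (Fin n)} (w : Fin m) {i : Fin n}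
    (h : i ∉ A) : liftOn P A w i = P i := if_neg h

theorem card_ne_liftOn_le (P : Profile m n) (A : Finset (Fin n)) (w : Fin m) :
    (Finset.univ.filter fun i => P i ≠ liftOn P A w i).card ≤ A.card := by
  refine Finset.card_le_card fun i hi => ?_
  by_contra h
  exact (Finset.mem_filter.1 hi).2 (liftOn_of_notMem P w h).symm

theorem numPrefer_add_numPrefer (P : Profile m n) {x y : Fin m} (h : x ≠ y) :
    numPrefer P x y + numPrefer P y x = n := by
  have h1 := Finset.card_filter_add_card_filter_not (s := (Finset.univ : Finset (Fin n)))
    (fun i => P i x < P i y)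
  rw [Finset.card_univ, Fintype.card_fin] at h1
  rw [numPrefer, numPrefer]
  convert h1 using 3
  ext i
  have := vote_val_ne (P i) h
  simp only [Finset.mem_filter, Finset.mem_univ, true_and, Fin.lt_def]
  omega

theorem majority_swap (P : Profile m n) (x y : Fin m) : majority P y x = -majority P x y := by
  simp [majority]

theorem numPrefer_liftOn_of_ne (P : Profile m n) (A : Finset (Fin n)) {w x y : Fin m}
    (hx : x ≠ w) (hy : y ≠ w) : numPrefer (liftOn P A w) x y = numPrefer P x y := by
  rw [numPrefer, numPrefer]
  congr 1
  ext i
  by_cases hi : i ∈ A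
  · simp [liftOn_of_mem P w hi, liftVote_lt_liftVote (P i) hx hy]
  · simp [liftOn_of_notMem P w hi]

theorem majority_liftOn_of_ne (P : Profile m n) (A : Finset (Fin n)) {w x y : Fin m}
    (hx : x ≠ w) (hy : y ≠ w) : majority (liftOn P A w) x y = majority P x y := by
  rw [majority, majority, numPrefer_liftOn_of_ne P A hx hy, numPrefer_liftOn_of_ne P A hy hx]

theorem numPrefer_liftOn_self (P : Profile m n) (A : Finset (Fin n)) {w y : Fin m} (hy : y ≠ w) :
    numPrefer (liftOn P A w) w y = numPrefer P w y + (A.filter fun i => P i y < P i w).card := by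
  rw [numPrefer, numPrefer, ← Finset.card_union_of_disjoint]
  · congr 1
    ext i
    by_cases hi : i ∈ A
    · simp only [Finset.mem_filter, Finset.mem_univ, true_and, Finset.mem_union, hi,
        liftOn_of_mem P w hi, liftVote_self_lt (P i) hy, true_iff]
      exact lt_or_gt_of_ne fun h => hy ((P i).injective h.symm)
    · simp [liftOn_of_notMem P w hi, hi]
  · refine Finset.disjoint_left.2 fun i hi hi' => ?_
    exact lt_asymm (Finset.mem_filter.1 hi).2 (Finset.mem_filter.1 hi').2

theorem majority_liftOn_self (P : Profile m n) (A : Finset (Fin n)) {w y : Fin m} (hy : y ≠ w) :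
    majority (liftOn P A w) w y =
      majority P w y + 2 * (A.filter fun i => P i y < P i w).card := by
  have h1 := numPrefer_liftOn_self P A hy
  have h2 := numPrefer_add_numPrefer P hy
  have h3 := numPrefer_add_numPrefer (liftOn P A w) hy
  rw [majority, majority]
  omega

theorem majority_le_majority_liftOn (P : Profile m n) (A : Finset (Fin n)) {w y : Fin m}
    (hy : y ≠ w) : majority P w y ≤ majority (liftOn P A w) w y := by
  rw [majority_liftOn_self P A hy]
  omega

/-- Moving `w` to the top helps no other candidate in any pairwise comparison. -/
theorem majority_liftOn_le (P : Profile m n) (A : Finset (Fin n)) {w x y : Fin m}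
    (hx : x ≠ w) : majority (liftOn P A w) x y ≤ majority P x y := by
  by_cases hy : y = w
  · subst hy
    have := majority_le_majority_liftOn P A hx
    rw [majority_swap P y, majority_swap _ y]
    omega
  · exact (majority_liftOn_of_ne P A hx hy).le

theorem numTop_liftOn_le (P : Profile m n) (A : Finset (Fin n)) {w x : Fin m} (hx : x ≠ w)
    (l : ℕ) : numTop (liftOn P A w) x l ≤ numTop P x l := by
  refine Finset.card_le_card fun i hi => ?_
  simp only [Finset.mem_filter, Finset.mem_univ, true_and] at hi ⊢
  by_cases h : i ∈ A
  · rw [liftOn_of_mem P w h] at hi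
    exact (le_liftVote_of_ne (P i) hx).trans_lt hi
  · rwa [liftOn_of_notMem P w h] at hi

theorem numTop_liftOn_self (P : Profile m n) (A : Finset (Fin n)) (w : Fin m) {l : ℕ}
    (hl : 1 ≤ l) :
    numTop (liftOn P A w) w l = numTop P w l + (A.filter fun i => l ≤ P i w).card := by
  rw [numTop, numTop, ← Finset.card_union_of_disjoint]
  · congr 1
    ext i
    by_cases hi : i ∈ A
    · simp only [Finset.mem_filter, Finset.mem_univ, true_and, Finset.mem_union, hi,
        liftOn_of_mem P w hi, liftVote_self]
      omega
    · simp [liftOn_of_notMem P w hi, hi]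
  · refine Finset.disjoint_left.2 fun i hi hi' => ?_
    exact absurd (Finset.mem_filter.1 hi).2 (not_lt.2 (Finset.mem_filter.1 hi').2)

theorem pluralityScore_liftOn_of_ne (P : Profile m n) (A : Finset (Fin n)) {w y : Fin m}
    (hy : y ≠ w) :
    pluralityScore (liftOn P A w) y + (A.filter fun i => (P i y : ℕ) = 0).card =
      pluralityScore P y := by
  rw [pluralityScore, pluralityScore, numTop, numTop, ← Finset.card_union_of_disjoint]
  · congr 1
    ext i
    by_cases hi : i ∈ A
    · have := liftVote_self_lt (P i) hy
      rw [Fin.lt_def, liftVote_self] at this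
      simp only [Finset.mem_filter, Finset.mem_univ, true_and, Finset.mem_union, hi,
        liftOn_of_mem P w hi]
      omega
    · simp [liftOn_of_notMem P w hi, hi]
  · refine Finset.disjoint_left.2 fun i hi hi' => ?_
    have hA := (Finset.mem_filter.1 hi').1
    have h1 := (Finset.mem_filter.1 hi).2
    have := liftVote_self_lt (P i) hy
    rw [Fin.lt_def, liftVote_self] at this
    rw [liftOn_of_mem P w hA] at h1
    omega

end Lift

/-! ### Small sets of voters that meet many large sets -/

/-- The sum on the left is large as long as some `S y` is rarely hit by `A`. -/
theorem exists_card_le_sum_half_pow_le {α ι : Type} [Fintype α] [DecidableEq α] (Y : Finset ι)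
    (S : ι → Finset α) (hS : ∀ y ∈ Y, Fintype.card α ≤ 4 * (S y).card) (k : ℕ)
    (hk : 8 * k ≤ Fintype.card α) :
    ∃ A : Finset α, A.card ≤ k ∧
      ∑ y ∈ Y, (1 / 2 : ℝ) ^ (A ∩ S y).card ≤ Y.card * (15 / 16) ^ k := by
  induction k with
  | zero => exact ⟨∅, by simp⟩
  | succ k ih =>
    obtain ⟨A, hA, hsum⟩ := ih (by omega)
    have hne : (Finset.univ : Finset α).Nonempty := by
      rw [Finset.univ_nonempty_iff, ← Fintype.card_pos_iff]
      omega
    -- A uniformly random further element lowers the sum by a factor `15 / 16` on average.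
    have key : ∑ v : α, ∑ y ∈ Y, (1 / 2 : ℝ) ^ (insert v A ∩ S y).card ≤
        ∑ _v : α, 15 / 16 * ∑ y ∈ Y, (1 / 2 : ℝ) ^ (A ∩ S y).card := by
      rw [Finset.sum_comm, Finset.sum_const, nsmul_eq_mul, Finset.card_univ, Finset.mul_sum,
        Finset.mul_sum]
      refine Finset.sum_le_sum fun y hy => ?_
      have hterm : ∀ v : α, (1 / 2 : ℝ) ^ (insert v A ∩ S y).card ≤
          (1 / 2) ^ (A ∩ S y).card * (1 - if v ∈ S y \ A then 1 / 2 else 0) := by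
        intro v
        split_ifs with hv
        · rw [Finset.mem_sdiff] at hv
          rw [Finset.insert_inter_of_mem hv.1, Finset.card_insert_of_notMem
            (fun h => hv.2 (Finset.mem_inter.1 h).1), pow_succ]
          linarith
        · rw [sub_zero, mul_one]
          exact pow_le_pow_of_le_one (by norm_num) (by norm_num)
            (Finset.card_le_card (Finset.inter_subset_inter_right (Finset.subset_insert v A)))
      refine (Finset.sum_le_sum fun v _ => hterm v).trans ?_
      rw [← Finset.mul_sum, Finset.sum_sub_distrib, Finset.sum_const, Finset.card_univ,
        ← Finset.sum_filter, Finset.filter_mem_eq_inter, Finset.univ_inter, Finset.sum_const,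
        nsmul_eq_mul, nsmul_eq_mul]
      have hcard : Fintype.card α ≤ 8 * (S y \ A).card := by
        have h1 := hS y hy
        have h2 := Finset.le_card_sdiff A (S y)
        omega
      have hcard' : (Fintype.card α : ℝ) ≤ 8 * (S y \ A).card := by exact_mod_cast hcard
      have hpos : (0 : ℝ) < (1 / 2) ^ (A ∩ S y).card := by positivity
      nlinarith
    obtain ⟨v, -, hv⟩ := Finset.exists_le_of_sum_le hne key
    refine ⟨insert v A, (Finset.card_insert_le v A).trans (by omega), hv.trans ?_⟩
    rw [pow_succ]
    nlinarith

/-- If at most `2 ^ τ` sets contain a quarter of all points each, then some `55 τ` points hit each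
of them `4 τ` times. -/
theorem exists_hitting_set {α ι : Type} [Fintype α] [DecidableEq α] (Y : Finset ι)
    (S : ι → Finset α) (hS : ∀ y ∈ Y, Fintype.card α ≤ 4 * (S y).card) (τ : ℕ)
    (hY : τ = 0 ∨ Y.card ≤ 2 ^ τ) (hτ : 500 * τ ≤ Fintype.card α) :
    ∃ A : Finset α, A.card ≤ 55 * τ ∧ ∀ y ∈ Y, 4 * τ ≤ (A ∩ S y).card := by
  rcases hY with rfl | hY
  · exact ⟨∅, by simp⟩
  obtain ⟨A, hA, hsum⟩ := exists_card_le_sum_half_pow_le Y S hS (55 * τ) (by omega)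
  refine ⟨A, hA, fun y hy => ?_⟩
  have h1 : (1 / 2 : ℝ) ^ (A ∩ S y).card ≤ ∑ y ∈ Y, (1 / 2 : ℝ) ^ (A ∩ S y).card :=
    Finset.single_le_sum (f := fun y => (1 / 2 : ℝ) ^ (A ∩ S y).card)
      (fun _ _ => by positivity) hy
  have h2 : (Y.card : ℝ) ≤ 2 ^ τ := by exact_mod_cast hY
  -- Eleven points halve the sum, which has to drop from `2 ^ τ` to `2 ^ (-4 τ)`.
  have h3 : ((15 : ℝ) / 16) ^ (55 * τ) ≤ (1 / 2) ^ (5 * τ) := by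
    rw [show 55 * τ = 11 * (5 * τ) by ring, pow_mul]
    exact pow_le_pow_left₀ (by positivity) (by norm_num) _
  have h4 : (1 / 2 : ℝ) ^ (A ∩ S y).card ≤ (1 / 2) ^ (4 * τ) := by
    calc (1 / 2 : ℝ) ^ (A ∩ S y).card ≤ Y.card * (15 / 16) ^ (55 * τ) := h1.trans hsum
      _ ≤ 2 ^ τ * (1 / 2) ^ (5 * τ) := by gcongr
      _ = (1 / 2) ^ (4 * τ) := by
        rw [show 5 * τ = τ + 4 * τ by ring, pow_add, ← mul_assoc, ← mul_pow]
        norm_num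
  exact (pow_le_pow_iff_right_of_lt_one₀ (by norm_num) (by norm_num)).1 h4

/-- Few voters who move `w` to the top improve all the pairwise comparisons of `w` that it does not
win clearly. -/
theorem exists_liftOn_majority {m n : ℕ} (P : Profile m n) (w : Fin m) {τ : ℕ}
    (hm : τ = 0 ∨ m ≤ 2 ^ τ) (hτ : 500 * τ ≤ n) :
    ∃ A : Finset (Fin n), A.card ≤ 55 * τ ∧ ∀ y, y ≠ w → majority P w y ≤ 4 * τ →
      majority P w y + 8 * τ ≤ majority (liftOn P A w) w y := by
  have hS : ∀ y ∈ Finset.univ.filter fun y => y ≠ w ∧ majority P w y ≤ 4 * τ,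
      Fintype.card (Fin n) ≤ 4 * (Finset.univ.filter fun i => P i y < P i w).card := by
    intro y hy
    simp only [Finset.mem_filter, Finset.mem_univ, true_and] at hy
    have h1 := numPrefer_add_numPrefer P hy.1
    have h2 := hy.2
    rw [majority] at h2
    change Fintype.card (Fin n) ≤ 4 * numPrefer P y w
    rw [Fintype.card_fin]
    omega
  have hY : τ = 0 ∨ (Finset.univ.filter fun y => y ≠ w ∧ majority P w y ≤ 4 * τ).card ≤ 2 ^ τ := by
    refine hm.imp_right fun h => (Finset.card_filter_le _ _).trans ?_
    simpa using h
  obtain ⟨A, hA, hit⟩ := exists_hitting_set _ _ hS τ hY (by simpa using hτ)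
  refine ⟨A, hA, fun y hy hD => ?_⟩
  have h := hit y (by simp [hy, hD])
  rw [Finset.inter_filter, Finset.inter_univ] at h
  rw [majority_liftOn_self P A hy]
  omega

/-! ### Winners that are robust against errors in the counts -/

/-- The statistics of a profile that the algorithm estimates: `inl (x, y)` stands for the number of
voters that prefer `x` to `y`, and `inr (x, l)` for the number of voters that rank `x` in one of
the positions `0, …, l`. -/
abbrev Statistic (m : ℕ) : Type := (Fin m × Fin m) ⊕ (Fin m × Fin m)

/-- Whether a vote is counted by a statistic. -/
def Statistic.holds {m : ℕ} : Statistic m → Vote m → Bool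
  | .inl (x, y), v => decide (v x < v y)
  | .inr (x, l), v => decide ((v x : ℕ) < l + 1)

/-- The value of a statistic on a profile. -/
def Statistic.count {m n : ℕ} (P : Profile m n) : Statistic m → ℕ
  | .inl (x, y) => numPrefer P x y
  | .inr (x, l) => numTop P x (l + 1)

theorem countP_ofFn {α : Type} {n : ℕ} (p : α → Bool) (f : Fin n → α) :
    (List.ofFn f).countP p = (Finset.univ.filter fun i => p (f i) = true).card := by
  induction n with
  | zero => simp
  | succ n ih =>
    rw [List.ofFn_succ, List.countP_cons, ih, Finset.card_filter, Finset.card_filter,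
      Fin.sum_univ_succ, add_comm]

theorem Statistic.countP_ofFn {m n : ℕ} (P : Profile m n) (i : Statistic m) :
    (List.ofFn P).countP i.holds = i.count P := by
  rw [_root_.countP_ofFn]
  rcases i with ⟨x, y⟩ | ⟨x, l⟩ <;> simp [holds, count, numPrefer, numTop]

/-- `e` estimates all statistics of `P` with an error of at most `τ`. -/
def Estimates {m n : ℕ} (e : Statistic m → ℝ) (τ : ℕ) (P : Profile m n) : Prop :=
  ∀ i, |e i - i.count P| ≤ τ

/-- Estimates of the statistics determine a candidate that can be made a winner by changing a number
of votes that is proportional to the error. If the error is positive, it has to be at least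
`log₂ m`. -/
def RobustRule (r : VotingRule) : Prop :=
  ∀ (m : ℕ), 1 ≤ m → ∀ (e : Statistic m → ℝ) (τ : ℕ), (τ = 0 ∨ m ≤ 2 ^ τ) →
    ∃ w : Fin m, ∀ (n : ℕ) (P : Profile m n), 1 ≤ n → Estimates e τ P → 500 * τ ≤ n →
      ∃ Q : Profile m n, w ∈ r m n Q ∧
        (Finset.univ.filter fun i => P i ≠ Q i).card ≤ 500 * τ

section Estimates

variable {m n : ℕ} {e : Statistic m → ℝ} {τ : ℕ} {P : Profile m n}

/-- The estimate of `D(x, y)`. -/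
def estMajority (e : Statistic m → ℝ) (x y : Fin m) : ℝ := e (.inl (x, y)) - e (.inl (y, x))

theorem Estimates.majority_le (h : Estimates e τ P) (x y : Fin m) :
    (majority P x y : ℝ) ≤ estMajority e x y + 2 * τ := by
  have h1 := abs_le.1 (h (.inl (x, y)))
  have h2 := abs_le.1 (h (.inl (y, x)))
  simp only [Statistic.count] at h1 h2
  rw [majority, estMajority]
  push_cast
  linarith

theorem Estimates.le_majority (h : Estimates e τ P) (x y : Fin m) :
    estMajority e x y - 2 * τ ≤ (majority P x y : ℝ) := by
  have h1 := abs_le.1 (h (.inl (x, y)))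
  have h2 := abs_le.1 (h (.inl (y, x)))
  simp only [Statistic.count] at h1 h2
  rw [majority, estMajority]
  push_cast
  linarith

end Estimates

/-- A candidate `w` with maximum estimated score is robust: no other candidate has a score above
`4 τ`, so it suffices to lift `w` in the comparisons below this bound. -/
theorem robustRule_maximin : RobustRule maximinRule := by
  intro m hm e τ hτm
  have hne : (Finset.univ : Finset (Fin m)).Nonempty := ⟨⟨0, hm⟩, Finset.mem_univ _⟩
  obtain ⟨w, -, hw⟩ := Finset.exists_max_image Finset.univ
    (fun x => (Finset.univ.erase x).inf fun y => (estMajority e x y : WithTop ℝ)) hne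
  have hw' : ∀ x y, x ≠ w → y ≠ w → ∃ z, z ≠ x ∧ estMajority e x z ≤ estMajority e w y := by
    intro x y hx hy
    obtain ⟨z, hz, hzeq⟩ := Finset.exists_mem_eq_inf (Finset.univ.erase x)
      ⟨w, by simp [hx.symm]⟩ (fun y => (estMajority e x y : WithTop ℝ))
    refine ⟨z, (Finset.mem_erase.1 hz).1, WithTop.coe_le_coe.1 ?_⟩
    rw [← hzeq]
    exact (hw x (Finset.mem_univ x)).trans (Finset.inf_le (by simp [hy]))
  refine ⟨w, fun n P _ hest hn => ?_⟩
  have hP : ∀ x y, x ≠ w → y ≠ w → ∃ z, z ≠ x ∧ majority P x z ≤ majority P w y + 4 * τ := by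
    intro x y hx hy
    obtain ⟨z, hz, hle⟩ := hw' x y hx hy
    refine ⟨z, hz, ?_⟩
    have h1 := hest.majority_le x z
    have h2 := hest.le_majority w y
    have : (majority P x z : ℝ) ≤ majority P w y + 4 * τ := by linarith
    exact_mod_cast this
  obtain ⟨A, hA, hlift⟩ := exists_liftOn_majority P w hτm hn
  refine ⟨liftOn P A w, fun x => ?_, (card_ne_liftOn_le P A w).trans (by omega)⟩
  by_cases hx : x = w
  · rw [hx]
  refine Finset.le_inf fun y hy => ?_
  have hy : y ≠ w := (Finset.mem_erase.1 hy).1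
  suffices h : ∃ z, z ≠ x ∧ majority (liftOn P A w) x z ≤ majority (liftOn P A w) w y by
    obtain ⟨z, hz, hle⟩ := h
    exact (Finset.inf_le (Finset.mem_erase.2 ⟨hz, Finset.mem_univ z⟩)).trans
      (WithTop.coe_le_coe.2 hle)
  rcases le_or_gt (majority P w y) (4 * τ) with hD | hD
  · obtain ⟨z, hz, hle⟩ := hP x y hx hy
    refine ⟨z, hz, ?_⟩
    have h1 := hlift y hy hD
    have h2 := majority_liftOn_le P A (y := z) hx
    omega
  · have h1 := majority_le_majority_liftOn P A hy
    rcases le_or_gt (majority P x w) (4 * τ) with hD' | hD'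
    · refine ⟨w, Ne.symm hx, ?_⟩
      have h2 := majority_liftOn_le P A (y := w) hx
      omega
    · obtain ⟨z, hz, hle⟩ := hP x x hx hx
      refine ⟨z, hz, ?_⟩
      have h2 := majority_liftOn_le P A (y := z) hx
      rw [majority_swap P x w] at hle
      omega

/-- The candidate that beats or nearly beats the most others according to the estimates is robust,
since it can be lifted to beat all of these. -/
theorem robustRule_copeland : RobustRule copelandRule := by
  classical
  intro m hm e τ hτm
  have hne : (Finset.univ : Finset (Fin m)).Nonempty := ⟨⟨0, hm⟩, Finset.mem_univ _⟩
  obtain ⟨w, -, hw⟩ := Finset.exists_max_image Finset.univ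
    (fun x => (Finset.univ.filter fun y => y ≠ x ∧ -(2 * τ : ℝ) < estMajority e x y).card) hne
  refine ⟨w, fun n P _ hest hn => ?_⟩
  obtain ⟨A, hA, hlift⟩ := exists_liftOn_majority P w hτm hn
  refine ⟨liftOn P A w, fun x => ?_, (card_ne_liftOn_le P A w).trans (by omega)⟩
  by_cases hx : x = w
  · rw [hx]
  calc copelandScore (liftOn P A w) x
      ≤ (Finset.univ.filter fun y => y ≠ x ∧ -(2 * τ : ℝ) < estMajority e x y).card := by
        refine Finset.card_le_card fun y hy => ?_
        simp only [Finset.mem_filter, Finset.mem_univ, true_and] at hy ⊢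
        refine ⟨hy.1, ?_⟩
        have h1 : (0 : ℝ) < majority P x y := by
          exact_mod_cast hy.2.trans_le (majority_liftOn_le P A hx)
        have h2 := hest.majority_le x y
        linarith
    _ ≤ _ := hw x (Finset.mem_univ x)
    _ ≤ copelandScore (liftOn P A w) w := by
        refine Finset.card_le_card fun y hy => ?_
        simp only [Finset.mem_filter, Finset.mem_univ, true_and] at hy ⊢
        refine ⟨hy.1, ?_⟩
        have h1 := hest.le_majority w y
        have h2 : (-(4 * τ : ℤ) : ℝ) < majority P w y := by
          have := hy.2
          push_cast
          linarith
        have h3 : -(4 * τ : ℤ) < majority P w y := by exact_mod_cast h2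
        have h4 := majority_le_majority_liftOn P A hy.1
        rcases le_or_gt (majority P w y) (4 * τ) with hD | hD
        · have := hlift y hy.1 hD
          omega
        · omega

theorem numTop_card {m n : ℕ} (P : Profile m n) (x : Fin m) {l : ℕ} (hl : m ≤ l) :
    numTop P x l = n := by
  rw [numTop, Finset.filter_true_of_mem fun i _ => (P i x).2.trans_le hl]
  simp

/-- A pair `(w, l)` with minimum `l` such that, according to the estimates, nearly half of the
voters rank `w` in the positions `0, …, l` gives a robust candidate. -/
theorem robustRule_bucklin : RobustRule bucklinRule := by
  classical
  intro m hm e τ _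
  -- All voters rank `z` in the positions `0, …, m - 1`, so this statistic estimates their number.
  set z : Fin m := ⟨m - 1, by omega⟩ with hz
  set E := Finset.univ.filter fun q : Fin m × Fin m => e (.inr (z, z)) / 2 - 2 * τ < e (.inr q)
    with hE
  have hmem : ∀ (n : ℕ) (P : Profile m n), Estimates e τ P → ∀ (x l : Fin m),
      n < 2 * numTop P x (l + 1) → (x, l) ∈ E := by
    intro n P hest x l hl
    have h1 := abs_le.1 (hest (.inr (z, z)))
    have h2 := abs_le.1 (hest (.inr (x, l)))
    simp only [Statistic.count] at h1 h2
    rw [numTop_card P z (by simp only [hz]; omega)] at h1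
    have hl' : (n : ℝ) < 2 * numTop P x (l + 1) := by exact_mod_cast hl
    have hτ : (0 : ℝ) ≤ τ := Nat.cast_nonneg τ
    simp only [hE, Finset.mem_filter, Finset.mem_univ, true_and]
    linarith
  have hmemz : ∀ (n : ℕ) (P : Profile m n), 1 ≤ n → Estimates e τ P → (z, z) ∈ E := by
    intro n P hn hest
    refine hmem n P hest z z ?_
    rw [numTop_card P z (by simp only [hz]; omega)]
    omega
  rcases E.eq_empty_or_nonempty with hE0 | hE0
  · refine ⟨z, fun n P hn hest _ => ?_⟩
    have := hmemz n P hn hest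
    simp [hE0] at this
  obtain ⟨⟨w, l⟩, hwl, hmin⟩ := Finset.exists_min_image E (fun q => q.2) hE0
  refine ⟨w, fun n P hn1 hest hn => ?_⟩
  have htop : n < 2 * numTop P w (l + 1) + 8 * τ := by
    have h1 := abs_le.1 (hest (.inr (z, z)))
    have h2 := abs_le.1 (hest (.inr (w, l)))
    simp only [Statistic.count] at h1 h2
    rw [numTop_card P z (by simp only [hz]; omega)] at h1
    simp only [hE, Finset.mem_filter, Finset.mem_univ, true_and] at hwl
    have hτ : (0 : ℝ) ≤ τ := Nat.cast_nonneg τ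
    have : (n : ℝ) < 2 * numTop P w (l + 1) + 8 * τ := by linarith
    exact_mod_cast this
  -- The voters that do not rank `w` in the positions `0, …, l`.
  set T := Finset.univ.filter fun i => (l : ℕ) + 1 ≤ P i w with hT
  have hTcard : numTop P w (l + 1) + T.card = n := by
    have h := Finset.card_filter_add_card_filter_not (s := (Finset.univ : Finset (Fin n)))
      (fun i => (P i w : ℕ) < l + 1)
    simp only [not_lt, Finset.card_univ, Fintype.card_fin] at h
    exact h
  obtain ⟨A, hAT, hA⟩ := Finset.exists_subset_card_eq (min_le_right (4 * τ) T.card)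
  refine ⟨liftOn P A w, fun x => ?_, (card_ne_liftOn_le P A w).trans (by omega)⟩
  by_cases hx : x = w
  · rw [hx]
  have hw : bucklinScore (liftOn P A w) w ≤ l + 1 := by
    refine Nat.sInf_le ?_
    change n < 2 * numTop (liftOn P A w) w (l + 1)
    rw [numTop_liftOn_self P A w (by omega), Finset.filter_true_of_mem
      fun i hi => (Finset.mem_filter.1 (hAT hi)).2]
    omega
  refine hw.trans ?_
  have hm' : m ∈ {L : ℕ | n < 2 * numTop (liftOn P A w) x L} := by
    change n < 2 * numTop (liftOn P A w) x m
    rw [numTop_card _ x le_rfl]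
    omega
  have hle : bucklinScore (liftOn P A w) x ≤ m := Nat.sInf_le hm'
  have hin : n < 2 * numTop (liftOn P A w) x (bucklinScore (liftOn P A w) x) :=
    Nat.sInf_mem ⟨m, hm'⟩
  generalize bucklinScore (liftOn P A w) x = L at hle hin
  obtain ⟨L, rfl⟩ : ∃ L', L = L' + 1 := by
    refine ⟨L - 1, ?_⟩
    rcases Nat.eq_zero_or_pos L with h0 | h0
    · simp [h0, numTop] at hin
    · omega
  have h := hmin (x, ⟨L, hle⟩) (hmem n P hest x ⟨L, hle⟩
    (hin.trans_le (Nat.mul_le_mul_left 2 (numTop_liftOn_le P A hx _))))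
  have h' : (l : ℕ) ≤ L := h
  omega

section Runoff

variable {m n : ℕ} {P : Profile m n} {w y : Fin m} {σ : ℕ}

/-- Voters who rank neither `w` nor `y` first can be used to raise the plurality score of either;
the comparison between `w` and `y` suffers from those that raise `y`. -/
theorem liftOn_liftOn_runoff (hwy : w ≠ y) {A B : Finset (Fin n)} (hAB : Disjoint A B)
    (hA : ∀ i ∈ A, (P i w : ℕ) ≠ 0 ∧ (P i y : ℕ) ≠ 0)
    (hB : ∀ i ∈ B, (P i w : ℕ) ≠ 0 ∧ (P i y : ℕ) ≠ 0) :
    pluralityScore (liftOn (liftOn P A w) B y) w = pluralityScore P w + A.card ∧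
    pluralityScore (liftOn (liftOn P A w) B y) y = pluralityScore P y + B.card ∧
    (∀ z, z ≠ w → z ≠ y →
      pluralityScore (liftOn (liftOn P A w) B y) z ≤ pluralityScore P z) ∧
    majority (liftOn (liftOn P A w) B y) w y = majority P w y +
      2 * (A.filter fun i => P i y < P i w).card - 2 * (B.filter fun i => P i w < P i y).card := by
  have hBP : ∀ i ∈ B, liftOn P A w i = P i := fun i hi =>
    liftOn_of_notMem P w (Finset.disjoint_right.1 hAB hi)
  refine ⟨?_, ?_, fun z hzw hzy => ?_, ?_⟩
  · have h1 := pluralityScore_liftOn_of_ne (liftOn P A w) B hwy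
    rw [Finset.filter_false_of_mem (fun i hi => by rw [hBP i hi]; exact (hB i hi).1),
      Finset.card_empty, add_zero] at h1
    rw [h1, pluralityScore, numTop_liftOn_self P A w le_rfl, Finset.filter_true_of_mem
      (fun i hi => Nat.one_le_iff_ne_zero.2 (hA i hi).1), pluralityScore]
  · have h1 := pluralityScore_liftOn_of_ne P A hwy.symm
    rw [Finset.filter_false_of_mem (fun i hi => (hA i hi).2),
      Finset.card_empty, add_zero] at h1
    rw [← h1, pluralityScore, numTop_liftOn_self _ B y le_rfl, Finset.filter_true_of_mem
      (fun i hi => by rw [hBP i hi]; exact Nat.one_le_iff_ne_zero.2 (hB i hi).2), pluralityScore]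
  · exact (numTop_liftOn_le _ B hzy 1).trans (numTop_liftOn_le P A hzw 1)
  · have h1 := majority_liftOn_self (liftOn P A w) B hwy
    have h2 := majority_liftOn_self P A hwy.symm
    rw [Finset.filter_congr (q := fun i => P i w < P i y)
      (fun i hi => by rw [hBP i hi])] at h1
    rw [majority_swap _ y w, h1, majority_swap _ w y, h2]
    ring

theorem card_ne_liftOn_liftOn_le (P : Profile m n) (A B : Finset (Fin n)) (w y : Fin m) :
    (Finset.univ.filter fun i => P i ≠ liftOn (liftOn P A w) B y i).card ≤ A.card + B.card := by
  refine le_trans (Finset.card_le_card fun i hi => ?_) (Finset.card_union_le A B)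
  by_contra h
  rw [Finset.mem_union, not_or] at h
  refine (Finset.mem_filter.1 hi).2 ?_
  rw [liftOn_of_notMem _ y h.2, liftOn_of_notMem P w h.1]

theorem pluralityScore_add_le (P : Profile m n) {x y z : Fin m} (hxy : x ≠ y) (hxz : x ≠ z)
    (hyz : y ≠ z) : pluralityScore P x + pluralityScore P y + pluralityScore P z ≤ n := by
  have hd : ∀ {a b : Fin m}, a ≠ b → Disjoint
      (Finset.univ.filter fun i => (P i a : ℕ) < 1)
      (Finset.univ.filter fun i => (P i b : ℕ) < 1) := by
    intro a b hab
    refine Finset.disjoint_left.2 fun i hi hi' => ?_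
    have h1 := (Finset.mem_filter.1 hi).2
    have h2 := (Finset.mem_filter.1 hi').2
    exact vote_val_ne (P i) hab (by omega)
  rw [pluralityScore, pluralityScore, pluralityScore, numTop, numTop, numTop,
    ← Finset.card_union_of_disjoint (hd hxy), ← Finset.card_union_of_disjoint
      (Finset.disjoint_union_left.2 ⟨hd hxz, hd hyz⟩)]
  exact (Finset.card_le_univ _).trans (by simp)

/-- If `w` and `y` nearly have the top two plurality scores and `w` nearly ties with `y` or wins,
then few changes make `w` a winner of the runoff. -/
theorem exists_runoff_repair (hwy : w ≠ y)
    (hw : ∀ z, z ≠ w → z ≠ y → pluralityScore P z ≤ pluralityScore P w + σ)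
    (hy : ∀ z, z ≠ w → z ≠ y → pluralityScore P z ≤ pluralityScore P y + σ)
    (hD : -(σ : ℤ) ≤ majority P w y) (hσ : 50 * σ ≤ n) :
    ∃ Q : Profile m n, IsTopTwo Q w y ∧ 0 ≤ majority Q w y ∧
      (Finset.univ.filter fun i => P i ≠ Q i).card ≤ 2 * σ := by
  classical
  set F := Finset.univ.filter fun i => (P i y : ℕ) ≠ 0 ∧ P i y < P i w with hF
  set Z := Finset.univ.filter fun i => (P i w : ℕ) ≠ 0 ∧ (P i y : ℕ) ≠ 0 with hZ
  have hFZ : F ⊆ Z := by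
    intro i hi
    simp only [hF, hZ, Finset.mem_filter, Finset.mem_univ, true_and, Fin.lt_def] at hi ⊢
    omega
  have hZ' : ∀ i ∈ Z, (P i w : ℕ) ≠ 0 ∧ (P i y : ℕ) ≠ 0 := fun i hi => (Finset.mem_filter.1 hi).2
  have split : ∀ X : Finset (Fin n), 2 * σ ≤ X.card →
      ∃ A B, A ⊆ X ∧ B ⊆ X ∧ Disjoint A B ∧ A.card = σ ∧ B.card = σ := by
    intro X hX
    obtain ⟨A, hAX, hA⟩ := Finset.exists_subset_card_eq (show σ ≤ X.card by omega)
    obtain ⟨B, hBX, hB⟩ := Finset.exists_subset_card_eq (s := X \ A) (n := σ)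
      (by rw [Finset.card_sdiff_of_subset hAX]; omega)
    exact ⟨A, B, hAX, hBX.trans Finset.sdiff_subset,
      Finset.disjoint_of_subset_right hBX Finset.disjoint_sdiff, hA, hB⟩
  by_cases hFσ : 2 * σ ≤ F.card
  · -- Voters in `F` can raise `y` without affecting the comparison of `w` and `y`.
    obtain ⟨A, B, hA, hB, hAB, hAc, hBc⟩ := split F hFσ
    obtain ⟨h1, h2, h3, h4⟩ := liftOn_liftOn_runoff hwy hAB
      (fun i hi => hZ' i (hFZ (hA hi))) (fun i hi => hZ' i (hFZ (hB hi)))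
    refine ⟨_, ⟨hwy, fun z hzw hzy => ?_⟩, ?_, (card_ne_liftOn_liftOn_le P A B w y).trans
      (by omega)⟩
    · have := h3 z hzw hzy
      have := hw z hzw hzy
      have := hy z hzw hzy
      omega
    · rw [h4, Finset.filter_true_of_mem (fun i hi => (Finset.mem_filter.1 (hA hi)).2.2),
        Finset.filter_false_of_mem (fun i hi => (Finset.mem_filter.1 (hB hi)).2.2.not_gt), hAc]
      simp
      omega
  by_cases hDσ : 2 * (σ : ℤ) ≤ majority P w y
  · by_cases hZσ : 2 * σ ≤ Z.card
    · obtain ⟨A, B, hA, hB, hAB, hAc, hBc⟩ := split Z hZσ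
      obtain ⟨h1, h2, h3, h4⟩ := liftOn_liftOn_runoff hwy hAB
        (fun i hi => hZ' i (hA hi)) (fun i hi => hZ' i (hB hi))
      refine ⟨_, ⟨hwy, fun z hzw hzy => ?_⟩, ?_, (card_ne_liftOn_liftOn_le P A B w y).trans
        (by omega)⟩
      · have := h3 z hzw hzy
        have := hw z hzw hzy
        have := hy z hzw hzy
        omega
      · have := Finset.card_filter_le B fun i => P i w < P i y
        omega
    · -- So few voters are left that all of them can be made to rank `w` or `y` first.
      obtain ⟨A, hA, hAc⟩ := Finset.exists_subset_card_eq (min_le_right σ Z.card)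
      have hBc : (Z \ A).card ≤ σ := by
        rw [Finset.card_sdiff_of_subset hA]
        omega
      obtain ⟨h1, h2, h3, h4⟩ := liftOn_liftOn_runoff (P := P) hwy
        (Finset.disjoint_sdiff (s := A) (t := Z))
        (fun i hi => hZ' i (hA hi)) (fun i hi => hZ' i (Finset.sdiff_subset hi))
      refine ⟨_, ⟨hwy, fun z hzw hzy => ?_⟩, ?_, (card_ne_liftOn_liftOn_le P A (Z \ A) w y).trans
        (by omega)⟩
      · suffices h : pluralityScore (liftOn (liftOn P A w) (Z \ A) y) z = 0 by
          rw [h]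
          omega
        rw [pluralityScore, numTop, Finset.card_eq_zero, Finset.filter_eq_empty_iff]
        intro i _ hi
        by_cases hiB : i ∈ Z \ A
        · have := liftVote_self_lt (liftOn P A w i) hzy
          rw [Fin.lt_def] at this
          rw [liftOn_of_mem _ y hiB] at hi
          omega
        rw [liftOn_of_notMem _ y hiB] at hi
        by_cases hiA : i ∈ A
        · have := liftVote_self_lt (P i) hzw
          rw [Fin.lt_def] at this
          rw [liftOn_of_mem P w hiA] at hi
          omega
        rw [liftOn_of_notMem P w hiA] at hi
        have h5 := vote_val_ne (P i) hzw
        have h6 := vote_val_ne (P i) hzy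
        refine hiB (Finset.mem_sdiff.2 ⟨Finset.mem_filter.2 ⟨Finset.mem_univ i, ?_⟩, hiA⟩)
        omega
      · have := Finset.card_filter_le (Z \ A) fun i => P i w < P i y
        omega
  · -- Nearly half of the voters rank `y` first, so some of them can be used to raise `w`.
    have hpref : numPrefer P y w ≤ pluralityScore P y + F.card := by
      refine le_trans (Finset.card_le_card fun i hi => ?_)
        (Finset.card_union_le (Finset.univ.filter fun i => (P i y : ℕ) < 1) F)
      simp only [hF, Finset.mem_union, Finset.mem_filter, Finset.mem_univ, true_and] at hi ⊢
      omega
    have hsum := numPrefer_add_numPrefer P hwy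
    have hhalf : n < 2 * pluralityScore P y + 6 * σ := by
      rw [majority] at hDσ
      omega
    have hmaj : majority P w y = numPrefer P w y - numPrefer P y w := rfl
    obtain ⟨A, hA, hAc⟩ := Finset.exists_subset_card_eq
      (s := Finset.univ.filter fun i => (P i y : ℕ) < 1) (n := 2 * σ)
      (by change 2 * σ ≤ pluralityScore P y; omega)
    have hA0 : ∀ i ∈ A, (P i y : ℕ) = 0 := fun i hi => by
      have := (Finset.mem_filter.1 (hA hi)).2
      omega
    have hAlt : ∀ i ∈ A, P i y < P i w := fun i hi => by
      have h1 := vote_val_ne (P i) hwy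
      have h2 := hA0 i hi
      rw [Fin.lt_def]
      omega
    have h1 : pluralityScore (liftOn P A w) w = pluralityScore P w + 2 * σ := by
      rw [pluralityScore, numTop_liftOn_self P A w le_rfl, Finset.filter_true_of_mem, hAc,
        pluralityScore]
      intro i hi
      have := hAlt i hi
      rw [Fin.lt_def] at this
      omega
    have h2 := pluralityScore_liftOn_of_ne P A hwy.symm
    rw [Finset.filter_true_of_mem hA0, hAc] at h2
    refine ⟨liftOn P A w, ⟨hwy, fun z hzw hzy => ?_⟩, ?_, (card_ne_liftOn_le P A w).trans hAc.le⟩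
    · have h3 : pluralityScore (liftOn P A w) z ≤ pluralityScore P z := numTop_liftOn_le P A hzw 1
      have h4 := pluralityScore_add_le P hzw hzy hwy
      have := hw z hzw hzy
      have := hy z hzw hzy
      omega
    · rw [majority_liftOn_self P A hwy.symm, Finset.filter_true_of_mem hAlt, hAc]
      push_cast
      omega

end Runoff

/-- The winner of the runoff between two candidates with the highest estimated plurality scores is
robust. -/
theorem robustRule_runoff : RobustRule runoffRule := by
  classical
  intro m hm e τ _
  set z₀ : Fin m := ⟨0, hm⟩ with hz₀
  by_cases hm1 : m = 1
  · subst hm1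
    exact ⟨z₀, fun n P _ _ _ => ⟨P, Or.inl fun x => Subsingleton.elim _ _, by simp⟩⟩
  obtain ⟨a, -, ha⟩ := Finset.exists_max_image Finset.univ (fun x => e (.inr (x, z₀)))
    ⟨z₀, Finset.mem_univ _⟩
  have hne : (Finset.univ.erase a).Nonempty := by
    rw [← Finset.card_pos, Finset.card_erase_of_mem (Finset.mem_univ a)]
    simp
    omega
  obtain ⟨b, hb, hbmax⟩ := Finset.exists_max_image _ (fun x => e (.inr (x, z₀))) hne
  have hab : a ≠ b := (Finset.ne_of_mem_erase hb).symm
  obtain ⟨w, y, hwy, htop, hD⟩ : ∃ w y : Fin m, w ≠ y ∧ (∀ z, z ≠ w → z ≠ y →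
      e (.inr (z, z₀)) ≤ e (.inr (w, z₀)) ∧ e (.inr (z, z₀)) ≤ e (.inr (y, z₀))) ∧
      0 ≤ estMajority e w y := by
    have htop : ∀ z, z ≠ a → e (.inr (z, z₀)) ≤ e (.inr (a, z₀)) ∧
        e (.inr (z, z₀)) ≤ e (.inr (b, z₀)) := fun z hz =>
      ⟨ha z (Finset.mem_univ z), hbmax z (Finset.mem_erase.2 ⟨hz, Finset.mem_univ z⟩)⟩
    rcases le_total 0 (estMajority e a b) with h | h
    · exact ⟨a, b, hab, fun z hz _ => htop z hz, h⟩
    · refine ⟨b, a, hab.symm, fun z _ hz => (htop z hz).symm, ?_⟩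
      rw [estMajority] at h ⊢
      linarith
  refine ⟨w, fun n P _ hest hn => ?_⟩
  have hpl : ∀ x z, e (.inr (z, z₀)) ≤ e (.inr (x, z₀)) →
      pluralityScore P z ≤ pluralityScore P x + 2 * τ := by
    intro x z hxz
    have h1 := abs_le.1 (hest (.inr (x, z₀)))
    have h2 := abs_le.1 (hest (.inr (z, z₀)))
    simp only [Statistic.count, hz₀, zero_add] at h1 h2 hxz
    have : (pluralityScore P z : ℝ) ≤ pluralityScore P x + 2 * τ := by
      rw [pluralityScore, pluralityScore]
      linarith
    exact_mod_cast this
  have hD' : -((2 * τ : ℕ) : ℤ) ≤ majority P w y := by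
    have h1 := hest.le_majority w y
    have : (-((2 * τ : ℕ) : ℤ) : ℝ) ≤ majority P w y := by
      push_cast
      linarith
    exact_mod_cast this
  obtain ⟨Q, hQ, hQD, hQc⟩ := exists_runoff_repair hwy
    (fun z h1 h2 => hpl w z (htop z h1 h2).1) (fun z h1 h2 => hpl y z (htop z h1 h2).2) hD'
    (by omega)
  exact ⟨Q, Or.inr ⟨y, hQ, hQD⟩, hQc.trans (by omega)⟩

/-! ### From counts in a sample to an `ε`-winner -/

theorem Statistic.count_le {m n : ℕ} (P : Profile m n) (i : Statistic m) : i.count P ≤ n := by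
  rw [← Statistic.countP_ofFn]
  exact List.countP_le_length.trans (by simp)

/-- The case of error `0`. -/
theorem RobustRule.exists_exact {r : VotingRule} (hr : RobustRule r) {m : ℕ} (hm : 1 ≤ m) :
    ∃ g : (Statistic m → ℕ) → Fin m, ∀ (n : ℕ) (P : Profile m n) (ε : ℝ), 1 ≤ n → 0 < ε →
      IsEpsWinner r ε P (g fun i => i.count P) := by
  choose g hg using fun c : Statistic m → ℕ => hr m hm (fun i => c i) 0 (Or.inl rfl)
  refine ⟨g, fun n P ε hn hε => ?_⟩
  obtain ⟨Q, hQ, hc⟩ := hg (fun i => i.count P) n P hn (fun i => by simp) (by omega)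
  refine ⟨Q, hQ, ?_⟩
  rw [Nat.le_zero.1 hc, Nat.cast_zero]
  positivity

/-- Counts `c` in a sample of rate `2⁻ᵏ` give estimates after scaling. The number of votes is not
known to the algorithm; its estimate provides a bound `τ` on the error, with `η n ≤ τ ≤ 4 η n`. -/
theorem RobustRule.exists_approx {r : VotingRule} (hr : RobustRule r) {m : ℕ} (hm : 1 ≤ m) (k : ℕ)
    {η : ℝ} (hη : 0 < η) (hη1 : η ≤ 1 / 2500) :
    ∃ g : (Statistic m → ℕ) → Fin m, ∀ (n : ℕ) (P : Profile m n) (ε : ℝ) (c : Statistic m → ℕ),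
      (∀ i, |(c i : ℝ) - (1 / 2) ^ k * i.count P| ≤ η * ((1 / 2) ^ k * n)) →
      1 ≤ η * n → Real.logb 2 m ≤ η * n → 2500 * η ≤ ε → IsEpsWinner r ε P (g c) := by
  -- The statistic `inr (z, z)` counts all voters.
  set z : Fin m := ⟨m - 1, by omega⟩ with hz
  set τ : (Statistic m → ℕ) → ℕ := fun c => ⌈2 * η * (2 ^ k * c (.inr (z, z)))⌉₊ with hτdef
  have key : ∀ c : Statistic m → ℕ, ∃ w : Fin m, m ≤ 2 ^ τ c → ∀ (n : ℕ) (P : Profile m n), 1 ≤ n →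
      Estimates (fun i => 2 ^ k * (c i : ℝ)) (τ c) P → 500 * τ c ≤ n →
      ∃ Q : Profile m n, w ∈ r m n Q ∧
        (Finset.univ.filter fun i => P i ≠ Q i).card ≤ 500 * τ c := by
    intro c
    by_cases h : m ≤ 2 ^ τ c
    · obtain ⟨w, hw⟩ := hr m hm (fun i => 2 ^ k * (c i : ℝ)) (τ c) (Or.inr h)
      exact ⟨w, fun _ => hw⟩
    · exact ⟨z, fun h' => absurd h' h⟩
  choose g hg using key
  refine ⟨g, fun n P ε c hc h1 hlog hε => ?_⟩
  have hn0 : (0 : ℝ) < n := by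
    rcases Nat.eq_zero_or_pos n with h | h
    · simp only [h, Nat.cast_zero, mul_zero] at h1
      linarith
    · exact_mod_cast h
  have hest : ∀ i : Statistic m, |2 ^ k * (c i : ℝ) - i.count P| ≤ η * n := by
    intro i
    have h2 : (2 : ℝ) ^ k * (1 / 2) ^ k = 1 := by rw [← mul_pow]; norm_num
    calc |2 ^ k * (c i : ℝ) - i.count P|
        = |2 ^ k * ((c i : ℝ) - (1 / 2) ^ k * i.count P)| := by
          rw [mul_sub, ← mul_assoc, h2, one_mul]
      _ = 2 ^ k * |(c i : ℝ) - (1 / 2) ^ k * i.count P| := by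
          rw [abs_mul, abs_of_pos (by positivity)]
      _ ≤ 2 ^ k * (η * ((1 / 2) ^ k * n)) := by gcongr; exact hc i
      _ = 2 ^ k * (1 / 2) ^ k * (η * n) := by ring
      _ = η * n := by rw [h2, one_mul]
  have hT := abs_le.1 (hest (.inr (z, z)))
  simp only [Statistic.count] at hT
  rw [numTop_card P z (by simp only [hz]; omega)] at hT
  have hηn : η * n ≤ n / 2500 := by nlinarith
  have hτ1 : η * n ≤ τ c := by
    refine le_trans ?_ (Nat.le_ceil _)
    nlinarith
  have hτ2 : (τ c : ℝ) ≤ 4 * (η * n) := by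
    refine (Nat.ceil_lt_add_one (by positivity)).le.trans ?_
    nlinarith
  have hmτ : m ≤ 2 ^ τ c := by
    have h3 := (Real.logb_le_iff_le_rpow (by norm_num) (by exact_mod_cast hm)).1 (hlog.trans hτ1)
    rw [Real.rpow_natCast] at h3
    exact_mod_cast h3
  have h500 : 500 * τ c ≤ n := by
    have : (500 : ℝ) * τ c ≤ n := by linarith
    exact_mod_cast this
  obtain ⟨Q, hQ, hQc⟩ := hg c hmτ n P (by exact_mod_cast hn0) (fun i => (hest i).trans hτ1) h500
  refine ⟨Q, hQ, ?_⟩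
  have h4 : ((Finset.univ.filter fun i => P i ≠ Q i).card : ℝ) ≤ 500 * τ c := by
    exact_mod_cast hQc
  nlinarith

/-! ### Choice of the sampling rate and the memory bound -/

/-- For a sample of expected size about `Λ`, the algorithm solves the winner determination problem
with counters up to `L`. -/
theorem RobustRule.exists_algorithm {r : VotingRule} (hr : RobustRule r) {c₁ c₂ ε δ η Λ : ℝ}
    {m n L : ℕ} (hm : 1 ≤ m) (hn : 1 ≤ n) (hc₁ : 0 < c₁) (hη : 0 < η) (hη1 : η ≤ 1 / 2500)
    (hηε : 2500 * η ≤ ε) (hδ : 0 < δ) (hδ1 : δ ≤ 1 / 2) (hc₁' : c₁ ≤ 1) (hc₂ : 0 ≤ c₂)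
    (hΛ : Λ = 4 * Real.log (4 * m ^ 2 / δ) / (c₁ * η ^ 2)) (hL : 4 * c₂ * Λ ≤ L) :
    ∃ (k : ℕ) (A : StreamAlgorithm (Vote m) (Fin m)
        (Nat.clog 2 ((k + 2) * (L + 1) ^ (2 * m ^ 2)))),
      2 ^ k ≤ n ∧ ∀ N : ℕ, c₁ * n ≤ N → (N : ℝ) ≤ c₂ * n →
        ∀ P : Profile m N, SolvesWinner r ε δ A P := by
  have hε : 0 < ε := by linarith
  have hm' : (1 : ℝ) ≤ m := by exact_mod_cast hm
  have hn' : (1 : ℝ) ≤ n := by exact_mod_cast hn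
  have hcard : Fintype.card (Statistic m) = 2 * m ^ 2 := by
    simp only [Statistic, Fintype.card_sum, Fintype.card_prod, Fintype.card_fin]
    ring
  have hx : 8 * (m : ℝ) ^ 2 ≤ 4 * m ^ 2 / δ := by
    rw [le_div_iff₀ hδ]
    nlinarith [sq_nonneg (m : ℝ)]
  have hx8 : (8 : ℝ) ≤ 4 * m ^ 2 / δ := by nlinarith
  have hlog1 : 1 ≤ Real.log (4 * m ^ 2 / δ) := by
    rw [Real.le_log_iff_exp_le (by linarith)]
    linarith [Real.exp_one_lt_d9]
  have hlogm : Real.log m ≤ Real.log (4 * m ^ 2 / δ) := by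
    refine Real.log_le_log (by linarith) ?_
    nlinarith
  have hΛη : c₁ * η ^ 2 * Λ = 4 * Real.log (4 * m ^ 2 / δ) := by
    rw [hΛ]
    field_simp
  have hΛ4 : 1 ≤ Λ := by
    rw [hΛ, le_div_iff₀ (by positivity)]
    have : η ^ 2 ≤ 1 := by nlinarith
    nlinarith
  rcases lt_or_ge (n : ℝ) Λ with hnΛ | hnΛ
  · -- The stream is so short that all votes can be counted.
    obtain ⟨g, hg⟩ := hr.exists_exact hm
    have hcount := exists_countingAlgorithm (fun i : Statistic m => i.holds) 0 L g
    rw [hcard] at hcount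
    obtain ⟨A, hA⟩ := hcount
    refine ⟨0, A, by simpa using hn, fun N hN1 hN2 P => ⟨(hA _).1, ?_⟩⟩
    have hN : 1 ≤ N := by
      have : (0 : ℝ) < N := lt_of_lt_of_le (by positivity) hN1
      exact_mod_cast this
    refine le_trans ?_ ((hA (List.ofFn P)).2 _)
    rw [bernoulliSample_zero]
    have hNL : N ≤ L := by
      have h1 : c₂ * n ≤ c₂ * Λ := by gcongr
      have h2 : 0 ≤ c₂ * Λ := by positivity
      have : (N : ℝ) ≤ L := by linarith
      exact_mod_cast this
    have hmem : List.ofFn P ∈ {S : List (Vote m) |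
        g (fun i => min (S.countP i.holds) L) ∈ {w | IsEpsWinner r ε P w}} := by
      have : (fun i : Statistic m => min ((List.ofFn P).countP i.holds) L) =
          fun i => i.count P := by
        funext i
        rw [Statistic.countP_ofFn]
        exact min_eq_left ((i.count_le P).trans hNL)
      simp only [Set.mem_ofPred_eq, this]
      exact hg N P ε hN hε
    rw [(PMF.toOuterMeasure_apply_eq_one_iff _ _).2 (by simpa using hmem)]
    exact ENNReal.ofReal_le_one.2 (by linarith)
  · obtain ⟨k, hk1, hk2⟩ := exists_nat_pow_near ((one_le_div (by linarith)).2 hnΛ)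
      (one_lt_two : (1 : ℝ) < 2)
    rw [le_div_iff₀ (by linarith)] at hk1
    rw [div_lt_iff₀ (by linarith), pow_succ] at hk2
    have hkn : 2 ^ k ≤ n := by
      have : (2 : ℝ) ^ k ≤ n := le_trans (le_mul_of_one_le_right (by positivity) hΛ4) hk1
      exact_mod_cast this
    obtain ⟨g, hg⟩ := hr.exists_approx hm k hη hη1
    have hcount := exists_countingAlgorithm (fun i : Statistic m => i.holds) k L g
    rw [hcard] at hcount
    obtain ⟨A, hA⟩ := hcount
    have hp : (0 : ℝ) < (1 / 2) ^ k := by positivity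
    have h2p : (1 / 2 : ℝ) ^ k * 2 ^ k = 1 := by rw [← mul_pow]; norm_num
    have hpn1 : Λ ≤ (1 / 2) ^ k * n := by
      calc Λ = (1 / 2) ^ k * (2 ^ k * Λ) := by rw [← mul_assoc, h2p, one_mul]
        _ ≤ _ := by gcongr
    have hpn2 : (1 / 2) ^ k * n ≤ 2 * Λ := by
      calc (1 / 2) ^ k * (n : ℝ) ≤ (1 / 2) ^ k * (2 ^ k * 2 * Λ) := by gcongr
        _ = ((1 / 2) ^ k * 2 ^ k) * (2 * Λ) := by ring
        _ = _ := by rw [h2p, one_mul]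
    have hconc := fun (N : ℕ) (P : Profile m N) => bernoulliSample_concentration (δ := δ) k
      (fun i : Statistic m => i.holds) hη (by linarith) (List.ofFn P)
    simp only [hcard, List.length_ofFn, Statistic.countP_ofFn] at hconc
    refine ⟨k, A, hkn, fun N hN1 hN2 P => ⟨(hA _).1, ?_⟩⟩
    refine (hconc N P ?_).trans ((MeasureTheory.measure_mono fun S hS => ?_).trans
      ((hA (List.ofFn P)).2 _))
    · have hpN : Real.log (4 * m ^ 2 / δ) ≤ η ^ 2 * ((1 / 2) ^ k * N) / 4 := by
        have : c₁ * Λ ≤ (1 / 2) ^ k * N := by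
          calc c₁ * Λ ≤ c₁ * ((1 / 2) ^ k * n) := by gcongr
            _ = (1 / 2) ^ k * (c₁ * n) := by ring
            _ ≤ _ := by gcongr
        linarith [mul_le_mul_of_nonneg_left this (sq_nonneg η)]
      have hexp : Real.exp (-(η ^ 2 * ((1 / 2) ^ k * N) / 4)) ≤ δ / (4 * m ^ 2) := by
        calc Real.exp (-(η ^ 2 * ((1 / 2) ^ k * N) / 4))
            ≤ Real.exp (-Real.log (4 * m ^ 2 / δ)) := Real.exp_le_exp.2 (by linarith)
          _ = δ / (4 * m ^ 2) := by
            rw [Real.exp_neg, Real.exp_log (by linarith), inv_div]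
      push_cast
      calc (2 * (m : ℝ) ^ 2) * (2 * Real.exp (-(η ^ 2 * ((1 / 2) ^ k * N) / 4)))
          ≤ (2 * (m : ℝ) ^ 2) * (2 * (δ / (4 * m ^ 2))) := by gcongr
        _ = δ := by field_simp; ring
    · have hS' : ∀ i : Statistic m, |(S.countP i.holds : ℝ) - (1 / 2) ^ k * i.count P| ≤
          η * ((1 / 2) ^ k * N) := hS
      have hpN2 : (1 / 2) ^ k * (N : ℝ) ≤ 2 * c₂ * Λ := by
        calc (1 / 2) ^ k * (N : ℝ) ≤ (1 / 2) ^ k * (c₂ * n) := by gcongr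
          _ = c₂ * ((1 / 2) ^ k * n) := by ring
          _ ≤ c₂ * (2 * Λ) := by gcongr
          _ = _ := by ring
      have hSL : ∀ i : Statistic m, S.countP i.holds ≤ L := by
        intro i
        have h1 := (abs_le.1 (hS' i)).2
        have h2 : (i.count P : ℝ) ≤ N := by exact_mod_cast i.count_le P
        have h3 : (1 / 2) ^ k * (i.count P : ℝ) ≤ (1 / 2) ^ k * N := by gcongr
        have h4 : (0 : ℝ) ≤ (1 / 2) ^ k * N := by positivity
        have h5 := mul_le_of_le_one_left h4 (show η ≤ 1 by linarith)
        have : (S.countP i.holds : ℝ) ≤ L := by linarith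
        exact_mod_cast this
      have hηN : 4 * 2500 * Real.log (4 * m ^ 2 / δ) ≤ η * N := by
        have h1 : c₁ * Λ ≤ N := le_trans (by gcongr) hN1
        have h2 : η * (c₁ * Λ) ≤ η * N := by gcongr
        have h3 : η * (η * (c₁ * Λ)) = 4 * Real.log (4 * m ^ 2 / δ) := by
          rw [← hΛη]
          ring
        have h4 : η * (η * (c₁ * Λ)) ≤ η * (η * N) := by gcongr
        have h5 : η * (η * N) ≤ 1 / 2500 * (η * N) := by gcongr
        linarith
      simp only [Set.mem_ofPred_eq, min_eq_left (hSL _)]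
      refine hg N P ε _ hS' (by linarith) ?_ hηε
      rw [Real.logb, div_le_iff₀ (Real.log_pos (by norm_num))]
      have := Real.log_two_gt_d9
      nlinarith

theorem one_le_lg (x : ℝ) : 1 ≤ lg x := le_max_left _ _

theorem logb_le_lg (x : ℝ) : Real.logb 2 x ≤ lg x := le_max_right _ _

theorem log_le_logb_two {x : ℝ} (hx : 1 ≤ x) : Real.log x ≤ Real.logb 2 x := by
  rw [Real.logb, le_div_iff₀ (Real.log_pos (by norm_num))]
  have h1 := Real.log_nonneg hx
  have h2 := Real.log_two_lt_d9
  nlinarith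

theorem clog_two_le {x : ℕ} (hx : 1 ≤ x) : (Nat.clog 2 x : ℝ) ≤ Real.logb 2 x + 1 := by
  have h := Real.natCeil_logb_natCast 2 x
  rw [← h, Nat.cast_ofNat]
  have hx' : (1 : ℝ) ≤ x := by exact_mod_cast hx
  exact (Nat.ceil_lt_add_one (Real.logb_nonneg (by norm_num) hx')).le

theorem log_sample_size_le {m : ℕ} {δ : ℝ} (hm : 1 ≤ m) (hδ : 0 < δ) :
    Real.log (4 * m ^ 2 / min δ (1 / 2)) ≤ 5 * (lg m * lg (1 / δ)) := by
  have hm' : (1 : ℝ) ≤ m := by exact_mod_cast hm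
  have hδ' : 0 < min δ (1 / 2) := lt_min hδ (by norm_num)
  have h1 : Real.log (1 / min δ (1 / 2)) ≤ lg (1 / δ) := by
    rcases le_total δ (1 / 2) with h | h
    · rw [min_eq_left h]
      refine (log_le_logb_two ?_).trans (logb_le_lg _)
      rw [le_div_iff₀ hδ]
      linarith
    · rw [min_eq_right h, one_div_one_div]
      exact (by linarith [Real.log_two_lt_d9] : Real.log 2 ≤ 1).trans (one_le_lg _)
  have h2 := (log_le_logb_two hm').trans (logb_le_lg _)
  have h3 : Real.log 4 ≤ 2 := by
    rw [show (4 : ℝ) = 2 ^ 2 by norm_num, Real.log_pow]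
    push_cast
    linarith [Real.log_two_lt_d9]
  have h4 : Real.log (4 * m ^ 2 / min δ (1 / 2)) =
      Real.log 4 + 2 * Real.log m + Real.log (1 / min δ (1 / 2)) := by
    rw [div_eq_mul_one_div, Real.log_mul (by positivity) (by positivity),
      Real.log_mul (by norm_num) (by positivity), Real.log_pow]
    push_cast
    ring
  rw [h4]
  nlinarith [one_le_lg (m : ℝ), one_le_lg (1 / δ), mul_nonneg
    (sub_nonneg.2 (one_le_lg (m : ℝ))) (sub_nonneg.2 (one_le_lg (1 / δ)))]

/-- The cost of the toss counter. -/
theorem logb_add_two_le {k n : ℕ} (hn : 1 ≤ n) (hk : 2 ^ k ≤ n) :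
    Real.logb 2 ((k + 2 : ℕ) : ℝ) ≤ 2 + lg (lg n) := by
  have hn0 : (0 : ℝ) < n := by exact_mod_cast hn
  have h1 : (k : ℝ) ≤ lg n := by
    refine le_trans ?_ (logb_le_lg _)
    rw [Real.le_logb_iff_rpow_le (by norm_num) hn0, Real.rpow_natCast]
    exact_mod_cast hk
  have h2 := one_le_lg (n : ℝ)
  calc Real.logb 2 ((k + 2 : ℕ) : ℝ) ≤ Real.logb 2 (2 ^ 2 * lg n) := by
        refine Real.logb_le_logb_of_le (by norm_num) (by positivity) ?_
        push_cast
        linarith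
    _ = 2 + Real.logb 2 (lg n) := by
        rw [Real.logb_mul (by norm_num) (by linarith), Real.logb_pow, Real.logb_self_eq_one
          (by norm_num)]
        norm_num
    _ ≤ _ := by
        have := logb_le_lg (lg n)
        linarith

/-- The cost of one saturating counter. -/
theorem logb_counter_le {a b ε δ Λ : ℝ} {m : ℕ} (ha : 0 < a) (ha1 : a ≤ 1) (hb : 1 ≤ b) (hm : 1 ≤ m)
    (hε : 0 < ε) (hδ : 0 < δ)
    (hΛ : Λ = 4 * Real.log (4 * m ^ 2 / min δ (1 / 2)) / (a * (min ε 1 / 2500) ^ 2)) :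
    Real.logb 2 ((⌈4 * b * Λ⌉₊ + 1 : ℕ) : ℝ) ≤
      Real.logb 2 (10 ^ 9 * b / a) + lg (lg m) + lg (lg (1 / δ)) + 2 * lg (1 / ε) := by
  have hε' : 0 < min ε 1 := lt_min hε one_pos
  have hε1 : min ε 1 ≤ 1 := min_le_right _ _
  have hX := one_le_lg (m : ℝ)
  have hY := one_le_lg (1 / δ)
  have hΛle : Λ ≤ 5 ^ 3 * 10 ^ 6 * (lg m * lg (1 / δ)) * (1 / min ε 1) ^ 2 / a := by
    rw [hΛ]
    have := log_sample_size_le hm hδ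
    calc _ ≤ 4 * (5 * (lg m * lg (1 / δ))) / (a * (min ε 1 / 2500) ^ 2) := by gcongr
      _ = _ := by field_simp; ring
  have hU : 1 ≤ lg m * lg (1 / δ) * (1 / min ε 1) ^ 2 / a := by
    have h1 : 1 ≤ 1 / min ε 1 := by rwa [le_div_iff₀ hε', one_mul]
    have h2 : 1 ≤ (1 / min ε 1) ^ 2 := one_le_pow₀ h1
    have h3 : 1 ≤ lg m * lg (1 / δ) := one_le_mul_of_one_le_of_one_le hX hY
    rw [le_div_iff₀ ha, one_mul]
    exact ha1.trans (one_le_mul_of_one_le_of_one_le h3 h2)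
  have hΛ0 : 0 ≤ Λ := by
    rw [hΛ]
    have hδ' : 0 < min δ (1 / 2) := lt_min hδ (by norm_num)
    have : 0 ≤ Real.log (4 * m ^ 2 / min δ (1 / 2)) := by
      refine Real.log_nonneg ?_
      rw [le_div_iff₀ hδ']
      have hm' : (1 : ℝ) ≤ m := by exact_mod_cast hm
      nlinarith [min_le_right δ (1 / 2)]
    positivity
  have hle : ((⌈4 * b * Λ⌉₊ + 1 : ℕ) : ℝ) ≤
      (10 ^ 9 * b / a) * (lg m * lg (1 / δ) * (1 / min ε 1) ^ 2) := by
    have h1 := (Nat.ceil_lt_add_one (show 0 ≤ 4 * b * Λ by positivity)).le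
    push_cast
    set U := lg m * lg (1 / δ) * (1 / min ε 1) ^ 2 / a with hUdef
    have h2 : Λ ≤ 5 ^ 3 * 10 ^ 6 * U := hΛle.trans (le_of_eq (by rw [hUdef]; ring))
    have h3 : (10 ^ 9 * b / a) * (lg m * lg (1 / δ) * (1 / min ε 1) ^ 2) = 10 ^ 9 * (b * U) := by
      rw [hUdef]
      ring
    rw [h3]
    have h4 : b * Λ ≤ b * (5 ^ 3 * 10 ^ 6 * U) := by gcongr
    have h5 : 1 ≤ b * U := one_le_mul_of_one_le_of_one_le hb hU
    linarith
  have hlε : Real.logb 2 (1 / min ε 1) ≤ lg (1 / ε) := by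
    rcases le_total ε 1 with h | h
    · rw [min_eq_left h]
      exact logb_le_lg _
    · rw [min_eq_right h]
      simpa using le_trans zero_le_one (one_le_lg (1 / ε))
  have hX0 : lg m ≠ 0 := by linarith
  have hY0 : lg (1 / δ) ≠ 0 := by linarith
  calc Real.logb 2 ((⌈4 * b * Λ⌉₊ + 1 : ℕ) : ℝ)
      ≤ Real.logb 2 ((10 ^ 9 * b / a) * (lg m * lg (1 / δ) * (1 / min ε 1) ^ 2)) :=
        Real.logb_le_logb_of_le (by norm_num) (by positivity) hle
    _ = Real.logb 2 (10 ^ 9 * b / a) + (Real.logb 2 (lg m) + Real.logb 2 (lg (1 / δ)) +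
          2 * Real.logb 2 (1 / min ε 1)) := by
        rw [Real.logb_mul (by positivity) (by positivity), Real.logb_mul (by positivity)
          (by positivity), Real.logb_mul hX0 hY0, Real.logb_pow]
        push_cast
        ring
    _ ≤ _ := by
        have := logb_le_lg (lg m)
        have := logb_le_lg (lg (1 / δ))
        linarith

theorem mainTheorem9 (c₁ c₂ : ℝ) (hc₁ : 0 < c₁) (hc₂ : c₁ ≤ c₂) :
    ∃ K : ℝ, 0 < K ∧
      ∀ r ∈ ({maximinRule, copelandRule, bucklinRule, runoffRule} : Set VotingRule),
      ∀ (m n : ℕ) (ε δ : ℝ), 1 ≤ m → 1 ≤ n → 0 < ε → 0 < δ →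
        ∃ (s : ℕ) (A : StreamAlgorithm (Vote m) (Fin m) s),
          (s : ℝ) ≤ K * ((m : ℝ) ^ 2 * (lg (lg m) + lg (1 / ε) + lg (lg (1 / δ))) + lg (lg n)) ∧
          ∀ N : ℕ, c₁ * n ≤ N → (N : ℝ) ≤ c₂ * n →
            ∀ P : Profile m N, SolvesWinner r ε δ A P := by
  set a := min c₁ 1 with ha
  set b := max c₂ 1 with hb
  have ha0 : 0 < a := lt_min hc₁ one_pos
  have ha1 : a ≤ 1 := min_le_right _ _
  have hb1 : 1 ≤ b := le_max_right _ _
  set K₀ := Real.logb 2 (10 ^ 9 * b / a) with hK₀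
  have hK₀0 : 0 ≤ K₀ := by
    refine Real.logb_nonneg (by norm_num) ?_
    rw [le_div_iff₀ ha0]
    linarith
  refine ⟨2 * K₀ + 4, by positivity, fun r hr m n ε δ hm hn hε hδ => ?_⟩
  have hrob : RobustRule r := by
    rcases hr with rfl | rfl | rfl | rfl
    exacts [robustRule_maximin, robustRule_copeland, robustRule_bucklin, robustRule_runoff]
  -- Only the truncations of `ε` at `1` and of `δ` at `1 / 2` matter.
  set Λ := 4 * Real.log (4 * m ^ 2 / min δ (1 / 2)) / (a * (min ε 1 / 2500) ^ 2) with hΛ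
  have hε' : 0 < min ε 1 := lt_min hε one_pos
  obtain ⟨k, A, hk, hA⟩ := hrob.exists_algorithm (ε := ε) (L := ⌈4 * b * Λ⌉₊) hm hn ha0
    (by positivity : 0 < min ε 1 / 2500) (by linarith [min_le_right ε 1])
    (by linarith [min_le_left ε 1]) (lt_min hδ (by norm_num)) (min_le_right δ _) ha1
    (by linarith : 0 ≤ b) hΛ (Nat.le_ceil _)
  refine ⟨_, A, ?_, fun N hN1 hN2 P => ?_⟩
  · set L := ⌈4 * b * Λ⌉₊
    have h1 := clog_two_le (x := (k + 2) * (L + 1) ^ (2 * m ^ 2)) (Nat.mul_pos (by omega)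
      (by positivity))
    have h2 : Real.logb 2 (((k + 2) * (L + 1) ^ (2 * m ^ 2) : ℕ) : ℝ) =
        Real.logb 2 ((k + 2 : ℕ) : ℝ) + 2 * m ^ 2 * Real.logb 2 ((L + 1 : ℕ) : ℝ) := by
      rw [Nat.cast_mul, Real.logb_mul (by positivity) (by positivity), Nat.cast_pow,
        Real.logb_pow]
      push_cast
      ring
    have h3 := logb_add_two_le hn hk
    have h4 : Real.logb 2 ((L + 1 : ℕ) : ℝ) ≤ _ := logb_counter_le ha0 ha1 hb1 hm hε hδ hΛ
    have h5 := one_le_lg (lg n)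
    have h6 := one_le_lg (lg m)
    have h7 := one_le_lg (lg (1 / δ))
    have h8 := one_le_lg (1 / ε)
    rw [h2] at h1
    have h9 : Real.logb 2 ((L + 1 : ℕ) : ℝ) ≤
        (K₀ + 2) * (lg (lg m) + lg (1 / ε) + lg (lg (1 / δ))) := by
      nlinarith
    have h10 : 2 * (m : ℝ) ^ 2 * Real.logb 2 ((L + 1 : ℕ) : ℝ) ≤
        2 * m ^ 2 * ((K₀ + 2) * (lg (lg m) + lg (1 / ε) + lg (lg (1 / δ)))) := by gcongr
    nlinarith
  · obtain ⟨h1, h2⟩ := hA N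
      ((mul_le_mul_of_nonneg_right (min_le_left _ _) (Nat.cast_nonneg n)).trans hN1)
      (hN2.trans (mul_le_mul_of_nonneg_right (le_max_left _ _) (Nat.cast_nonneg n))) P
    exact ⟨h1, le_trans (ENNReal.ofReal_le_ofReal (by linarith [min_le_left δ (1 / 2)])) h2⟩
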